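/- **Theorem 4.4.** For a finite group $G$ (written multiplicatively), let $\mathcal B(G)$ be the monoid of product-one sequences over $G$, i.e. of all finite unordered sequences of elements of $G$ (repetition allowed) whose terms can be ordered so that their product is $1_G$; the operation is concatenation and the empty sequence is the identity element. Let $\mathsf D(G)$, the large Davenport constant, be the maximal number of terms of an atom (irreducible element) of $\mathcal B(G)$. For $S \in \mathcal B(G)$, let $\mathsf L(S)$ be the set of all $k \in \mathbb N$ such that $S$ is a product of $k$ atoms of $\mathcal B(G)$, with $\mathsf L(S) = \{0\}$ if $S$ is the empty sequence, and let $\mathcal L(G) = \{\mathsf L(S) : S \in \mathcal B(G)\}$ be the system of sets of lengths. Write $C_m$ for a cyclic group of order $m$ and $D_{2n}$ for the dihedral group of order $2n$. Let $G$ and $G^*$ be finite groups and let $n \ge 3$ be an odd integer. 1. If $|G|$ is odd and $|G| \ge 3$, then $\{2, \mathsf D(G)\} \in \mathcal L(G)$ if and only if $G \cong C_{\mathsf D(G)}$. 2. If $|G|$ is odd and $|G| \ge 3$, and $G^*$ is cyclic with $\mathcal L(G^*) = \mathcal L(G)$, then $G^* \cong G$. 3. We have $\{2, \mathsf D(D_{2n})\}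 \in \mathcal L(D_{2n})$, and there is an $L \in \mathcal L(D_{2n})$ with $\{2, \mathsf D(D_{2n})\} \subsetneq L$. 4. If $G^*$ is abelian, then $\mathcal L(G^*) \ne \mathcal L(D_{2n})$. -/

import Mathlib

/-- The monoid of product-one sequences over `G`: a sequence is a finite multiset of elements
of `G` (an element of the free abelian monoid with basis `G`, written additively), and it is a
product-one sequence if its terms can be ordered in such a way that their product is `1`. -/
def productOne (G : Type*) [Group G] : AddSubmonoid (Multiset G) where
  carrier := {S | ∃ l : List G, (l : Multiset G) = S ∧ l.prod = 1}
  zero_mem' := ⟨[], rfl, rfl⟩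
  add_mem' := by
    rintro S T ⟨l, rfl, hl⟩ ⟨m, rfl, hm⟩
    exact ⟨l ++ m, by simp, by simp [hl, hm]⟩

/-- The set of lengths of an element `a` of a commutative monoid (written additively): it is
`{0}` if `a` is invertible, and otherwise it consists of all `k ≥ 1` such that `a` is a sum of
`k` atoms. (Sums of a positive number of atoms are never invertible.) -/
def setOfLengths {H : Type*} [AddCommMonoid H] (a : H) : Set ℕ :=
  {k | (k = 0 ∧ IsAddUnit a) ∨
    (0 < k ∧ ∃ s : Multiset H, (∀ u ∈ s, AddIrreducible u) ∧ s.card = k ∧ s.sum = a)}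

/-- The system of sets of lengths of the monoid of product-one sequences over `G`. -/
def systemOfLengths (G : Type*) [Group G] : Set (Set ℕ) :=
  {L | ∃ S : productOne G, setOfLengths S = L}

/-- The set of all lengths (numbers of terms) of atoms of the monoid of product-one sequences. -/
def atomLengths (G : Type*) [Group G] : Set ℕ :=
  {m | ∃ S : productOne G, AddIrreducible S ∧ (S : Multiset G).card = m}

/-- The large Davenport constant of a finite group `G`: the maximal number of terms of an atom of
the monoid of product-one sequences. For finite `G` the supremum is a maximum, see
`isGreatest_davenport`. -/
noncomputable def davenport (G : Type*) [Group G] : ℕ :=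
  sSup (atomLengths G)

theorem productOne_isAddUnit_iff {G : Type*} [Group G] (S : productOne G) :
    IsAddUnit S ↔ (S : Multiset G) = 0 := by
  constructor
  · intro h
    obtain ⟨T, hT⟩ := h.exists_neg
    have h1 : (S : Multiset G) + T = 0 := by
      have := congrArg (fun x : productOne G => (x : Multiset G)) hT
      simpa using this
    exact (add_eq_zero.mp h1).1
  · intro h
    have : S = 0 := Subtype.ext h
    rw [this]
    exact isAddUnit_zero

theorem atomLengths_le_card {G : Type*} [Group G] [Finite G] {m : ℕ} (hm : m ∈ atomLengths G) :
    m ≤ Nat.card G := by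
  obtain ⟨S, hS, rfl⟩ := hm
  obtain ⟨l, hl, hprod⟩ := S.2
  by_contra! hlt
  have hlen : Nat.card G < l.length := by
    rw [← hl] at hlt
    simpa using hlt
  have : Fintype G := Fintype.ofFinite G
  obtain ⟨x, y, hxy, hf⟩ := Fintype.exists_ne_map_eq_of_card_lt
    (fun i : Fin l.length => (l.take i).prod) (by simpa [Nat.card_eq_fintype_card] using hlen)
  wlog hlt' : x < y generalizing x y
  · exact this y x hxy.symm hf.symm (lt_of_le_of_ne (not_lt.mp hlt') hxy.symm)
  obtain ⟨i, hi⟩ := x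
  obtain ⟨j, hj⟩ := y
  simp only [Fin.mk_lt_mk] at hlt'
  simp only at hf
  set A := l.take i with hA
  set B := (l.take j).drop i with hB
  set C := l.drop j with hC
  have hAB : A ++ B = l.take j := by
    have := List.take_append_drop i (l.take j)
    rwa [List.take_take, min_eq_left hlt'.le] at this
  have hABC : A ++ B ++ C = l := by rw [hAB, List.take_append_drop]
  have hB1 : B.prod = 1 := by
    rw [← hAB, List.prod_append] at hf
    exact (mul_eq_left.mp hf.symm)
  have hAC : (A ++ C).prod = 1 := by
    rw [← hABC, List.prod_append, List.prod_append, hB1, mul_one] at hprod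
    rw [List.prod_append, hprod]
  have hsum : S = (⟨(B : Multiset G), B, rfl, hB1⟩ : productOne G) +
      ⟨((A ++ C : List G) : Multiset G), A ++ C, rfl, hAC⟩ := by
    apply Subtype.ext
    rw [← hl, ← hABC]
    simp only [AddSubmonoid.coe_add, ← Multiset.coe_add]
    abel
  rcases hS.2 hsum with h | h
  · rw [productOne_isAddUnit_iff] at h
    have h0 : B.length = 0 := by simpa using congrArg Multiset.card h
    simp [hB] at h0
    omega
  · rw [productOne_isAddUnit_iff] at h
    have h0 : (A ++ C).length = 0 := by simpa using congrArg Multiset.card h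
    simp [hC] at h0
    omega

/-- For finite `G`, the supremum that defines the Davenport constant is a maximum. -/
theorem isGreatest_davenport (G : Type*) [Group G] [Finite G] :
    IsGreatest (atomLengths G) (davenport G) := by
  have hb : BddAbove (atomLengths G) := ⟨Nat.card G, fun _ hm => atomLengths_le_card hm⟩
  have hne : (atomLengths G).Nonempty := by
    refine ⟨1, ⟨({1} : Multiset G), [1], rfl, by simp⟩, ⟨?_, ?_⟩, by simp⟩
    · rw [productOne_isAddUnit_iff]
      simp
    · intro a b hab
      have h1 : (a : Multiset G).card + (b : Multiset G).card = 1 := by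
        have := congrArg (fun x : productOne G => (x : Multiset G).card) hab
        simpa using this.symm
      rw [productOne_isAddUnit_iff, productOne_isAddUnit_iff, ← Multiset.card_eq_zero,
        ← Multiset.card_eq_zero]
      omega
  exact ⟨Nat.sSup_mem hne hb, fun m hm => le_csSup hb hm⟩

/-! Write D for the large Davenport constant, taken at least 3, and X⁻¹ for the sequence of inverses
of the terms of X. If S is a product of two atoms and also of D atoms, then 1 does not occur in S,
so the D atoms have at least two terms each, while the two have at most D each. Hence equality holds
throughout: the two atoms have length D, and S = X + X⁻¹ with |X| = D. Conversely U + U⁻¹ has the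
lengths 2 and D for every atom U of length D. So the system of sets of lengths determines D
(`davenport_eq_of_systemOfLengths_eq`).

Suppose that there are no other lengths. In odd order X can be chosen without pairs x, x⁻¹. An atom
T inside X yields a factorization into T, T⁻¹ and |X| - |T| pairs, which forces T = X. Since X is
minimal of maximal length, all its orderings have product 1 and the products of its subsequences
fill G, so G is abelian. Inverting all copies of one term x does not change X + X⁻¹, so the result
is minimal too; this leaves only X = x^D and G = ⟨x⟩ (`IsMinimalProductOne.eq_replicate_of_flip`).

An abelian group with the set {2, D} has exponent 2 or is cyclic of order D. In both cases V + V⁻¹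
has no further lengths for any atom V of length D, so {2, D} is maximal
(`eq_of_subset_of_mem_systemOfLengths`). In the dihedral group D = 2n, and two atoms of this length
behave differently: n copies of each of two reflections give {2, 2n}, whereas 2n - 2 copies of a
rotation with two copies of a reflection also give the length n + 2. -/

/-- A nonempty product-one sequence that is not the concatenation of two nonempty product-one
sequences. -/
def IsProductOneAtom {G : Type*} [Group G] (S : Multiset G) : Prop :=
  S ∈ productOne G ∧ S ≠ 0 ∧
    ∀ A ∈ productOne G, ∀ B ∈ productOne G, A + B = S → A = 0 ∨ B = 0

/-- The set of lengths of a sequence, in terms of multisets of sequences. -/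
def lengths {G : Type*} [Group G] (S : Multiset G) : Set ℕ :=
  {k | ∃ s : Multiset (Multiset G), (∀ u ∈ s, IsProductOneAtom u) ∧ s.card = k ∧ s.sum = S}

section Multiset

theorem mem_multiset_sum_iff {α : Type*} {a : α} {s : Multiset (Multiset α)} :
    a ∈ s.sum ↔ ∃ u ∈ s, a ∈ u :=
  Multiset.mem_join

/-- If `1` does not occur in `S`, all atoms of a factorization have at least two terms; in the
extremal case all of them have exactly two terms. -/
theorem two_mul_card_le_card_sum {α : Type*} {s : Multiset (Multiset α)} (hs : ∀ u ∈ s, 2 ≤ u.card) :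
    2 * s.card ≤ s.sum.card ∧ (s.sum.card = 2 * s.card → ∀ u ∈ s, u.card = 2) := by
  induction s using Multiset.induction_on with
  | empty => simp
  | cons a s ih =>
    obtain ⟨h1, h2⟩ := ih fun u hu => hs u (Multiset.mem_cons_of_mem hu)
    have ha := hs a (Multiset.mem_cons_self a s)
    simp only [Multiset.sum_cons, Multiset.card_add, Multiset.card_cons]
    refine ⟨by omega, fun h u hu => ?_⟩
    rcases Multiset.mem_cons.1 hu with rfl | hu
    · omega
    · exact h2 (by omega) u hu

end Multiset

/-! ### Atoms, factorizations and the Davenport constant in arbitrary groups. -/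

section Basic

variable {G : Type*} [Group G]

theorem addIrreducible_iff_isProductOneAtom (S : productOne G) :
    AddIrreducible S ↔ IsProductOneAtom (S : Multiset G) := by
  constructor
  · intro h
    refine ⟨S.2, fun h0 => h.1 ((productOne_isAddUnit_iff S).2 h0), fun A hA B hB hAB => ?_⟩
    have := h.2 (a := ⟨A, hA⟩) (b := ⟨B, hB⟩) (Subtype.ext hAB.symm)
    simpa only [productOne_isAddUnit_iff] using this
  · intro h
    refine ⟨fun h0 => h.2.1 ((productOne_isAddUnit_iff S).1 h0), fun A B hAB => ?_⟩
    simp only [productOne_isAddUnit_iff]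
    exact h.2.2 A A.2 B B.2 (by rw [hAB]; rfl)

theorem coe_multiset_sum (s : Multiset (productOne G)) :
    ((s.sum : productOne G) : Multiset G) = (s.map Subtype.val).sum :=
  AddSubmonoid.coe_multiset_sum _ s

theorem setOfLengths_eq_lengths (S : productOne G) :
    setOfLengths S = lengths (S : Multiset G) := by
  ext k
  constructor
  · rintro (⟨rfl, h⟩ | ⟨-, s, hs, hk, hsum⟩)
    · exact ⟨0, by simp, rfl, by simpa using ((productOne_isAddUnit_iff S).1 h).symm⟩
    · refine ⟨s.map Subtype.val, ?_, by simpa using hk, ?_⟩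
      · intro u hu
        obtain ⟨v, hv, rfl⟩ := Multiset.mem_map.1 hu
        exact (addIrreducible_iff_isProductOneAtom v).1 (hs v hv)
      · rw [← coe_multiset_sum, hsum]
  · rintro ⟨s, hs, hk, hsum⟩
    rcases Nat.eq_zero_or_pos k with rfl | hpos
    · left
      rw [Multiset.card_eq_zero] at hk
      subst hk
      exact ⟨rfl, (productOne_isAddUnit_iff S).2 (by simpa using hsum.symm)⟩
    · right
      refine ⟨hpos, ?_⟩
      lift s to Multiset (productOne G) using fun u hu => (hs u hu).1
      refine ⟨s, fun u hu => ?_, by simpa using hk, Subtype.ext ?_⟩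
      · exact (addIrreducible_iff_isProductOneAtom u).2 (hs u (Multiset.mem_map_of_mem _ hu))
      · rw [coe_multiset_sum, hsum]

theorem mem_systemOfLengths_iff {L : Set ℕ} :
    L ∈ systemOfLengths G ↔ ∃ S ∈ productOne G, lengths S = L := by
  constructor
  · rintro ⟨S, hS⟩
    exact ⟨S, S.2, by rw [← setOfLengths_eq_lengths, hS]⟩
  · rintro ⟨S, hS, hL⟩
    exact ⟨⟨S, hS⟩, by rw [setOfLengths_eq_lengths, hL]⟩

theorem mem_atomLengths_iff {m : ℕ} :
    m ∈ atomLengths G ↔ ∃ S : Multiset G, IsProductOneAtom S ∧ S.card = m := by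
  constructor
  · rintro ⟨S, hS, hm⟩
    exact ⟨S, (addIrreducible_iff_isProductOneAtom S).1 hS, hm⟩
  · rintro ⟨S, hS, hm⟩
    exact ⟨⟨S, hS.1⟩, (addIrreducible_iff_isProductOneAtom ⟨S, hS.1⟩).2 hS, hm⟩

theorem IsProductOneAtom.card_le [Finite G] {S : Multiset G} (hS : IsProductOneAtom S) :
    S.card ≤ davenport G :=
  (isGreatest_davenport G).2 (mem_atomLengths_iff.2 ⟨S, hS, rfl⟩)

theorem exists_isProductOneAtom_card_eq_davenport [Finite G] :
    ∃ S : Multiset G, IsProductOneAtom S ∧ S.card = davenport G :=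
  mem_atomLengths_iff.1 (isGreatest_davenport G).1

theorem davenport_le_card [Finite G] : davenport G ≤ Nat.card G :=
  atomLengths_le_card (isGreatest_davenport G).1

/-- Rotating an ordering conjugates its product, so a product-one ordering can start with any
prescribed term. -/
theorem cons_mem_productOne_iff {a : G} {T : Multiset G} :
    a ::ₘ T ∈ productOne G ↔ ∃ l : List G, (l : Multiset G) = T ∧ a * l.prod = 1 := by
  constructor
  · rintro ⟨l, hl, hp⟩
    have ha : a ∈ l := by
      rw [← Multiset.mem_coe, hl]
      exact Multiset.mem_cons_self a T
    obtain ⟨l₁, l₂, rfl⟩ := List.append_of_mem ha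
    refine ⟨l₂ ++ l₁, ?_, ?_⟩
    · apply (Multiset.cons_inj_right a).1
      rw [← hl, Multiset.cons_coe, Multiset.coe_eq_coe]
      exact (List.perm_append_comm (l₁ := a :: l₂) (l₂ := l₁))
    · simp only [List.prod_append, List.prod_cons] at hp ⊢
      have := mul_eq_one_iff_inv_eq.1 hp
      rw [← mul_assoc, ← this, inv_mul_cancel]
  · rintro ⟨l, rfl, hp⟩
    exact ⟨a :: l, by simp, by simpa using hp⟩

theorem one_cons_mem_productOne_iff {T : Multiset G} :
    1 ::ₘ T ∈ productOne G ↔ T ∈ productOne G := by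
  rw [cons_mem_productOne_iff]
  simp only [one_mul]
  rfl

theorem singleton_mem_productOne_iff {a : G} : ({a} : Multiset G) ∈ productOne G ↔ a = 1 := by
  rw [← Multiset.cons_zero, cons_mem_productOne_iff]
  simp

theorem pair_mem_productOne_iff {a b : G} :
    ({a, b} : Multiset G) ∈ productOne G ↔ a * b = 1 := by
  rw [Multiset.insert_eq_cons, cons_mem_productOne_iff]
  constructor
  · rintro ⟨l, hl, hp⟩
    rw [← Multiset.coe_singleton, Multiset.coe_eq_coe, List.perm_singleton] at hl
    simpa [hl] using hp
  · intro h
    exact ⟨[b], rfl, by simpa using h⟩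

theorem map_inv_mem_productOne {S : Multiset G} (hS : S ∈ productOne G) :
    S.map (·⁻¹) ∈ productOne G := by
  obtain ⟨l, rfl, hl⟩ := hS
  refine ⟨(l.map (·⁻¹)).reverse, by simp, ?_⟩
  rw [← List.prod_inv_reverse, hl, inv_one]

@[simp]
theorem map_inv_map_inv (S : Multiset G) : (S.map (·⁻¹)).map (·⁻¹) = S := by
  simp

theorem IsProductOneAtom.map_inv {S : Multiset G} (hS : IsProductOneAtom S) :
    IsProductOneAtom (S.map (·⁻¹)) := by
  refine ⟨map_inv_mem_productOne hS.1, by simpa using hS.2.1, fun A hA B hB hAB => ?_⟩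
  have h := hS.2.2 _ (map_inv_mem_productOne hA) _ (map_inv_mem_productOne hB)
    (by rw [← Multiset.map_add, hAB, map_inv_map_inv])
  simpa using h

theorem isProductOneAtom_pair {x y : G} (hx : x ≠ 1) (h : x * y = 1) :
    IsProductOneAtom ({x, y} : Multiset G) := by
  have hy : y ≠ 1 := by
    rintro rfl
    exact hx (by simpa using h)
  refine ⟨pair_mem_productOne_iff.2 h, by simp, fun A hA B hB hAB => ?_⟩
  have hc := congrArg Multiset.card hAB
  rw [Multiset.card_add, Multiset.card_pair] at hc
  by_contra! hne
  have hA0 := Multiset.card_pos.2 hne.1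
  have hB0 := Multiset.card_pos.2 hne.2
  obtain ⟨a, rfl⟩ := Multiset.card_eq_one.1 (show A.card = 1 by omega)
  rw [singleton_mem_productOne_iff] at hA
  have : a ∈ ({x, y} : Multiset G) := by
    rw [← hAB]
    simp
  simp only [Multiset.insert_eq_cons, Multiset.mem_cons, Multiset.mem_singleton] at this
  rcases this with rfl | rfl
  · exact hx hA
  · exact hy hA

theorem IsProductOneAtom.eq_singleton_one {U : Multiset G} (hU : IsProductOneAtom U)
    (h1 : (1 : G) ∈ U) : U = {1} := by
  obtain ⟨T, rfl⟩ := Multiset.exists_cons_of_mem h1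
  have hT : T ∈ productOne G := one_cons_mem_productOne_iff.1 hU.1
  rcases hU.2.2 {1} (singleton_mem_productOne_iff.2 rfl) T hT (Multiset.singleton_add 1 T) with
    h | h
  · simp at h
  · simp [h]

theorem IsProductOneAtom.two_le_card {U : Multiset G} (hU : IsProductOneAtom U)
    (h1 : (1 : G) ∉ U) : 2 ≤ U.card := by
  by_contra! h
  have h0 := Multiset.card_pos.2 hU.2.1
  obtain ⟨a, rfl⟩ := Multiset.card_eq_one.1 (show U.card = 1 by omega)
  have := singleton_mem_productOne_iff.1 hU.1
  simp [this] at h1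

theorem exists_eq_pair_of_card_eq_two {U : Multiset G} (hU : U ∈ productOne G)
    (hc : U.card = 2) : ∃ x : G, U = {x, x⁻¹} := by
  obtain ⟨x, y, rfl⟩ := Multiset.card_eq_two.1 hc
  exact ⟨x, by rw [eq_inv_of_mul_eq_one_right (pair_mem_productOne_iff.1 hU)]⟩

theorem exists_factorization (S : Multiset G) (hS : S ∈ productOne G) :
    ∃ s : Multiset (Multiset G), (∀ u ∈ s, IsProductOneAtom u) ∧ s.sum = S := by
  induction h : S.card using Nat.strong_induction_on generalizing S with
  | _ m ih =>
    by_cases h0 : S = 0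
    · exact ⟨0, by simp, by simp [h0]⟩
    by_cases hat : IsProductOneAtom S
    · exact ⟨{S}, by simpa using hat, by simp⟩
    simp only [IsProductOneAtom, not_and, not_forall, not_or] at hat
    obtain ⟨A, hA, B, hB, hAB, hA0, hB0⟩ := hat hS h0
    have hA' := Multiset.card_pos.2 hA0
    have hB' := Multiset.card_pos.2 hB0
    have hc := congrArg Multiset.card hAB
    rw [Multiset.card_add] at hc
    obtain ⟨s, hs, hsA⟩ := ih A.card (by omega) A hA rfl
    obtain ⟨t, ht, htB⟩ := ih B.card (by omega) B hB rfl
    refine ⟨s + t, fun u hu => ?_, by rw [Multiset.sum_add, hsA, htB, hAB]⟩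
    rcases Multiset.mem_add.1 hu with hu | hu
    · exact hs u hu
    · exact ht u hu

theorem exists_atom_le {S : Multiset G} (hS : S ∈ productOne G) (h0 : S ≠ 0) :
    ∃ T ≤ S, IsProductOneAtom T := by
  obtain ⟨s, hs, rfl⟩ := exists_factorization S hS
  obtain ⟨T, hT⟩ := Multiset.exists_mem_of_ne_zero (s := s) (by rintro rfl; simp at h0)
  exact ⟨T, Multiset.le_sum_of_mem hT, hs T hT⟩

theorem add_mem_lengths {A B : Multiset G} {k m : ℕ} (hk : k ∈ lengths A) (hm : m ∈ lengths B) :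
    k + m ∈ lengths (A + B) := by
  obtain ⟨s, hs, rfl, rfl⟩ := hk
  obtain ⟨t, ht, rfl, rfl⟩ := hm
  refine ⟨s + t, fun u hu => ?_, by simp, by simp⟩
  rcases Multiset.mem_add.1 hu with hu | hu
  · exact hs u hu
  · exact ht u hu

theorem IsProductOneAtom.one_mem_lengths {U : Multiset G} (hU : IsProductOneAtom U) :
    1 ∈ lengths U :=
  ⟨{U}, by simpa using hU, by simp, by simp⟩

theorem mem_productOne_of_mem_lengths {S : Multiset G} {k : ℕ} (h : k ∈ lengths S) :
    S ∈ productOne G := by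
  obtain ⟨s, hs, -, rfl⟩ := h
  exact AddSubmonoid.multiset_sum_mem _ s fun u hu => (hs u hu).1

theorem two_mem_lengths_iff {S : Multiset G} :
    2 ∈ lengths S ↔ ∃ U V, IsProductOneAtom U ∧ IsProductOneAtom V ∧ U + V = S := by
  constructor
  · rintro ⟨s, hs, hc, hsum⟩
    obtain ⟨U, V, rfl⟩ := Multiset.card_eq_two.1 hc
    exact ⟨U, V, hs U (by simp), hs V (by simp), by simpa using hsum⟩
  · rintro ⟨U, V, hU, hV, rfl⟩
    exact add_mem_lengths hU.one_mem_lengths hV.one_mem_lengths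

theorem IsProductOneAtom.eq_one_of_mem_lengths {U : Multiset G} (hU : IsProductOneAtom U) {k : ℕ}
    (hk : k ∈ lengths U) : k = 1 := by
  obtain ⟨s, hs, rfl, hsum⟩ := hk
  obtain ⟨T, hT⟩ := Multiset.exists_mem_of_ne_zero (s := s)
    (by rintro rfl; exact hU.2.1 (by simpa using hsum.symm))
  obtain ⟨t, rfl⟩ := Multiset.exists_cons_of_mem hT
  rw [Multiset.sum_cons] at hsum
  have ht : t.sum ∈ productOne G :=
    AddSubmonoid.multiset_sum_mem _ t fun u hu => (hs u (Multiset.mem_cons_of_mem hu)).1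
  rcases hU.2.2 T (hs T hT).1 _ ht hsum with h | h
  · exact absurd h (hs T hT).2.1
  · have : t = 0 := by
      by_contra h0
      obtain ⟨v, hv⟩ := Multiset.exists_mem_of_ne_zero h0
      have hle := Multiset.le_sum_of_mem hv
      rw [h] at hle
      exact (hs v (Multiset.mem_cons_of_mem hv)).2.1 (Multiset.le_zero.1 hle)
    simp [this]

theorem card_mem_lengths_add_map_inv {X : Multiset G} (h1 : (1 : G) ∉ X) :
    X.card ∈ lengths (X + X.map (·⁻¹)) := by
  induction X using Multiset.induction_on with
  | empty => exact ⟨0, by simp, by simp, by simp⟩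
  | cons a X ih =>
    rw [Multiset.mem_cons, not_or] at h1
    have hp := isProductOneAtom_pair (Ne.symm h1.1) (mul_inv_cancel a)
    have := add_mem_lengths (ih h1.2) hp.one_mem_lengths
    rw [Multiset.card_cons]
    convert this using 2
    rw [Multiset.map_cons, Multiset.insert_eq_cons, ← Multiset.singleton_add,
      ← Multiset.singleton_add a, ← Multiset.singleton_add a⁻¹]
    abel

theorem exists_eq_add_map_inv {s : Multiset (Multiset G)} (hs : ∀ u ∈ s, IsProductOneAtom u)
    (hs2 : ∀ u ∈ s, u.card = 2) :
    ∃ X : Multiset G, X.card = s.card ∧ s.sum = X + X.map (·⁻¹) := by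
  induction s using Multiset.induction_on with
  | empty => exact ⟨0, by simp⟩
  | cons a s ih =>
    obtain ⟨X, hX, hsum⟩ := ih (fun u hu => hs u (Multiset.mem_cons_of_mem hu))
      fun u hu => hs2 u (Multiset.mem_cons_of_mem hu)
    have ha := Multiset.mem_cons_self a s
    obtain ⟨x, rfl⟩ := exists_eq_pair_of_card_eq_two (hs a ha).1 (hs2 a ha)
    refine ⟨x ::ₘ X, by simp [hX], ?_⟩
    rw [Multiset.sum_cons, hsum, Multiset.map_cons, Multiset.insert_eq_cons,
      ← Multiset.singleton_add, ← Multiset.singleton_add x, ← Multiset.singleton_add x⁻¹]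
    abel

/-- The term 1 is an atom by itself in every factorization. Removing it from a factorization of
length 2 leaves a single atom, so 2 would be the only length. -/
theorem one_notMem_of_two_mem_lengths {S : Multiset G} {k : ℕ} (h2 : 2 ∈ lengths S)
    (hk : k ∈ lengths S) (hk3 : k ≠ 2) : (1 : G) ∉ S := by
  obtain ⟨U, V, hU, hV, rfl⟩ := two_mem_lengths_iff.1 h2
  have key : ∀ {U V : Multiset G}, IsProductOneAtom V → k ∈ lengths (U + V) → U = {1} → False := by
    rintro U V hV hk rfl
    obtain ⟨s, hs, hc, hsum⟩ := hk
    have h1 : (1 : G) ∈ s.sum := by simp [hsum]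
    obtain ⟨T, hT, h1T⟩ := mem_multiset_sum_iff.1 h1
    obtain ⟨t, rfl⟩ := Multiset.exists_cons_of_mem hT
    rw [(hs T hT).eq_singleton_one h1T, Multiset.sum_cons, add_right_inj] at hsum
    have := hV.eq_one_of_mem_lengths ⟨t, fun u hu => hs u (Multiset.mem_cons_of_mem hu), rfl, hsum⟩
    rw [Multiset.card_cons] at hc
    omega
  intro h1
  rcases Multiset.mem_add.1 h1 with h | h
  · exact key hV hk (hU.eq_singleton_one h)
  · exact key hU (by rwa [add_comm]) (hV.eq_singleton_one h)

theorem two_le_card_of_mem {s : Multiset (Multiset G)} (hs : ∀ u ∈ s, IsProductOneAtom u)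
    (h1 : (1 : G) ∉ s.sum) : ∀ u ∈ s, 2 ≤ u.card := fun u hu =>
  (hs u hu).two_le_card fun h => h1 (mem_multiset_sum_iff.2 ⟨u, hu, h⟩)

/-- Counting terms gives 2k ≤ |U| + |V| ≤ 2D; the bound k ≥ 3 serves to exclude the term 1. -/
theorem le_davenport_of_two_mem_lengths [Finite G] {S : Multiset G} {k : ℕ}
    (h2 : 2 ∈ lengths S) (hk : k ∈ lengths S) (hk3 : 3 ≤ k) : k ≤ davenport G := by
  have h1 := one_notMem_of_two_mem_lengths h2 hk (by omega)
  obtain ⟨U, V, hU, hV, rfl⟩ := two_mem_lengths_iff.1 h2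
  obtain ⟨s, hs, rfl, hsum⟩ := hk
  have := (two_mul_card_le_card_sum (two_le_card_of_mem hs (hsum ▸ h1))).1
  rw [hsum, Multiset.card_add] at this
  have := hU.card_le
  have := hV.card_le
  omega

/-- Equality case of the same count: all D atoms are pairs x, x⁻¹, and one term from each forms X.
-/
theorem exists_of_two_davenport_mem_lengths [Finite G] {S : Multiset G} (hD : 3 ≤ davenport G)
    (h2 : 2 ∈ lengths S) (hk : davenport G ∈ lengths S) :
    (1 : G) ∉ S ∧ ∃ U V X : Multiset G, IsProductOneAtom U ∧ IsProductOneAtom V ∧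
      U.card = davenport G ∧ V.card = davenport G ∧ X.card = davenport G ∧ S = U + V ∧
      S = X + X.map (·⁻¹) := by
  have h1 := one_notMem_of_two_mem_lengths h2 hk (by omega)
  refine ⟨h1, ?_⟩
  obtain ⟨U, V, hU, hV, rfl⟩ := two_mem_lengths_iff.1 h2
  obtain ⟨s, hs, hc, hsum⟩ := hk
  have h := two_mul_card_le_card_sum (two_le_card_of_mem hs (hsum ▸ h1))
  rw [hsum, Multiset.card_add] at h
  have := hU.card_le
  have := hV.card_le
  obtain ⟨X, hX, hsX⟩ := exists_eq_add_map_inv hs (h.2 (by omega))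
  exact ⟨U, V, X, hU, hV, by omega, by omega, by omega, rfl, by rw [← hsX, hsum]⟩

theorem exists_two_davenport_mem_lengths [Finite G] (hD : 3 ≤ davenport G) :
    ∃ L ∈ systemOfLengths G, 2 ∈ L ∧ davenport G ∈ L := by
  obtain ⟨U, hU, hc⟩ := exists_isProductOneAtom_card_eq_davenport (G := G)
  have h1 : (1 : G) ∉ U := fun h => by
    rw [hU.eq_singleton_one h, Multiset.card_singleton] at hc
    omega
  have h2 := two_mem_lengths_iff.2 ⟨U, _, hU, hU.map_inv, rfl⟩
  exact ⟨_, mem_systemOfLengths_iff.2 ⟨_, mem_productOne_of_mem_lengths h2, rfl⟩, h2,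
    hc ▸ card_mem_lengths_add_map_inv h1⟩

theorem davenport_le_of_systemOfLengths_eq {H : Type*} [Group H] [Finite G] [Finite H]
    (h : systemOfLengths G = systemOfLengths H) (hD : 3 ≤ davenport G) :
    davenport G ≤ davenport H := by
  obtain ⟨L, hL, h2, hk⟩ := exists_two_davenport_mem_lengths hD
  rw [h] at hL
  obtain ⟨S, -, rfl⟩ := mem_systemOfLengths_iff.1 hL
  exact le_davenport_of_two_mem_lengths h2 hk hD

theorem davenport_eq_of_systemOfLengths_eq {H : Type*} [Group H] [Finite G] [Finite H]
    (h : systemOfLengths G = systemOfLengths H) (hD : 3 ≤ davenport G) :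
    davenport G = davenport H := by
  have := davenport_le_of_systemOfLengths_eq h hD
  exact le_antisymm this (davenport_le_of_systemOfLengths_eq h.symm (by omega))

/-- Add to Z the inverse of the product of some ordering. The result has more than D terms, so it
splits, and the part without the added term lies in Z. -/
theorem exists_le_mem_productOne [Finite G] {Z : Multiset G} (hZ : davenport G ≤ Z.card)
    (hZ0 : Z ≠ 0) : ∃ T ≤ Z, T ≠ 0 ∧ T ∈ productOne G := by
  classical
  by_contra! hfree
  obtain ⟨l, rfl⟩ : ∃ l : List G, (l : Multiset G) = Z := Quot.exists_rep Z
  have hmem : (l.prod)⁻¹ ::ₘ (l : Multiset G) ∈ productOne G :=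
    cons_mem_productOne_iff.2 ⟨l, rfl, by simp⟩
  have hat : IsProductOneAtom ((l.prod)⁻¹ ::ₘ (l : Multiset G)) := by
    refine ⟨hmem, by simp, fun A hA B hB hAB => ?_⟩
    have key : ∀ {A B : Multiset G}, B ∈ productOne G → A + B = (l.prod)⁻¹ ::ₘ (l : Multiset G) →
        (l.prod)⁻¹ ∈ A → B = 0 := by
      intro A B hB hAB hmem
      obtain ⟨A', rfl⟩ := Multiset.exists_cons_of_mem hmem
      rw [Multiset.cons_add, Multiset.cons_inj_right] at hAB
      by_contra h0
      exact hfree B (by rw [← hAB]; exact Multiset.le_add_left _ _) h0 hB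
    have hm : (l.prod)⁻¹ ∈ A + B := by
      rw [hAB]
      exact Multiset.mem_cons_self _ _
    rcases Multiset.mem_add.1 hm with h | h
    · exact Or.inr (key hB hAB h)
    · exact Or.inl (key hA (by rwa [add_comm]) h)
  have := hat.card_le
  rw [Multiset.card_cons] at this
  omega

theorem isProductOneAtom_replicate_orderOf [Finite G] (x : G) :
    IsProductOneAtom (Multiset.replicate (orderOf x) x) := by
  have key : ∀ j, Multiset.replicate j x ∈ productOne G ↔ x ^ j = 1 := by
    intro j
    constructor
    · rintro ⟨l, hl, hp⟩
      rw [← Multiset.coe_replicate, Multiset.coe_eq_coe] at hl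
      rwa [List.perm_replicate.1 hl, List.prod_replicate] at hp
    · intro h
      exact ⟨List.replicate j x, Multiset.coe_replicate j x, by rwa [List.prod_replicate]⟩
  have hpos := orderOf_pos x
  refine ⟨(key _).2 (pow_orderOf_eq_one x), fun h => ?_, fun A hA B hB hAB => ?_⟩
  · have := congrArg Multiset.card h
    simp only [Multiset.card_replicate, Multiset.card_zero] at this
    omega
  · have hc := congrArg Multiset.card hAB
    rw [Multiset.card_add, Multiset.card_replicate] at hc
    have hA' : A = Multiset.replicate A.card x := Multiset.eq_replicate_card.2 fun b hb =>
      Multiset.eq_of_mem_replicate (hAB ▸ Multiset.mem_add.2 (Or.inl hb))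
    rw [hA', key] at hA
    have := orderOf_dvd_of_pow_eq_one hA
    rw [← Multiset.card_eq_zero, ← Multiset.card_eq_zero]
    rcases Nat.eq_zero_or_pos A.card with h | h
    · exact Or.inl h
    · have := Nat.le_of_dvd h this
      omega

theorem orderOf_le_davenport [Finite G] (x : G) : orderOf x ≤ davenport G := by
  simpa using (isProductOneAtom_replicate_orderOf x).card_le

end Basic

/-! ### Minimal product-one sequences of maximal length. -/

/-- A nonempty product-one sequence without nonempty proper product-one subsequences. In a
nonabelian group this is stronger than being an atom. -/
def IsMinimalProductOne {G : Type*} [Group G] (X : Multiset G) : Prop :=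
  X ∈ productOne G ∧ X ≠ 0 ∧ ∀ T ≤ X, T ∈ productOne G → T = 0 ∨ T = X

section Minimal

variable {G : Type*} [Group G]

/-- Replacing terms by their inverses does not change `X + X⁻¹`. -/
theorem map_add_map_inv_eq {f : G → G} (hf : ∀ x, f x = x ∨ f x = x⁻¹) (X : Multiset G) :
    X.map f + (X.map f).map (·⁻¹) = X + X.map (·⁻¹) := by
  induction X using Multiset.induction_on with
  | empty => simp
  | cons a X ih =>
    simp only [Multiset.map_cons, Multiset.cons_add, Multiset.add_cons]
    rw [ih]
    rcases hf a with h | h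
    · rw [h]
    · rw [h, inv_inv, Multiset.cons_swap]

/-- A set of representatives of the pairs `{x, x⁻¹}` when there are no involutions. -/
theorem exists_orientation {X : Multiset G} (h1 : (1 : G) ∉ X) (hodd : Odd (Nat.card G)) :
    ∃ Y : Multiset G, Y.card = X.card ∧ Y + Y.map (·⁻¹) = X + X.map (·⁻¹) ∧
      ∀ x y, ({x, y} : Multiset G) ≤ Y → x * y ≠ 1 := by
  classical
  let _ : LinearOrder G := WellOrderingRel.isWellOrder.linearOrder
  -- Pick the smaller of x and x⁻¹ in an arbitrary linear order. Two picks that are mutually inverse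
  -- then coincide, so they are an involution or 1.
  let f : G → G := fun x => if x ≤ x⁻¹ then x else x⁻¹
  have hf : ∀ x, f x = x ∨ f x = x⁻¹ := fun x => by
    by_cases h : x ≤ x⁻¹ <;> simp [f, h]
  have hle : ∀ x, f x ≤ (f x)⁻¹ := fun x => by
    by_cases h : x ≤ x⁻¹
    · simp [f, h]
    · simp [f, h, (not_le.1 h).le]
  refine ⟨X.map f, by simp, map_add_map_inv_eq hf X, fun x y hxy h => ?_⟩
  have hx : x ∈ X.map f := Multiset.mem_of_le hxy (by simp)
  have hy : y ∈ X.map f := Multiset.mem_of_le hxy (by simp)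
  obtain ⟨u, hu, rfl⟩ := Multiset.mem_map.1 hx
  obtain ⟨v, hv, hvy⟩ := Multiset.mem_map.1 hy
  have hyu := eq_inv_of_mul_eq_one_right h
  have h2 := hle v
  rw [hvy, hyu, inv_inv] at h2
  have h3 : f u = (f u)⁻¹ := le_antisymm (hle u) h2
  have h4 : orderOf (f u) ∣ 2 := by
    rw [orderOf_dvd_iff_pow_eq_one, pow_two]
    nth_rewrite 2 [h3]
    simp
  have h5 : Odd (orderOf (f u)) := hodd.of_dvd_nat (orderOf_dvd_natCard _)
  have h6 : orderOf (f u) = 1 := by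
    rcases (Nat.dvd_prime Nat.prime_two).1 h4 with h | h
    · exact h
    · rw [h] at h5
      exact absurd h5 (by decide)
  rw [orderOf_eq_one_iff] at h6
  rcases hf u with h | h
  · exact h1 (by rwa [← h6, h])
  · rw [h6, eq_comm, inv_eq_one] at h
    exact h1 (by rwa [← h])

variable [Finite G]

/-- If X = T + R with an atom T, then X + X⁻¹ factors into T, T⁻¹ and |R| pairs. The length 2 + |R|
equals 2 only if R is empty, and D only if |T| = 2, which `hpair` excludes. -/
theorem isMinimalProductOne_of_lengths_subset {X : Multiset G} (hD : 3 ≤ davenport G)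
    (hX : X.card = davenport G) (h1 : (1 : G) ∉ X)
    (hL : lengths (X + X.map (·⁻¹)) ⊆ {2, davenport G})
    (hpair : ∀ x y, ({x, y} : Multiset G) ≤ X → x * y ≠ 1) : IsMinimalProductOne X := by
  have hatom : ∀ T ≤ X, IsProductOneAtom T → T = X := by
    intro T hT hat
    obtain ⟨R, rfl⟩ := Multiset.le_iff_exists_add.1 hT
    have hR : (1 : G) ∉ R := fun h => h1 (Multiset.mem_add.2 (Or.inr h))
    have hm := add_mem_lengths (add_mem_lengths hat.one_mem_lengths hat.map_inv.one_mem_lengths)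
      (card_mem_lengths_add_map_inv hR)
    have hm' : 1 + 1 + R.card ∈ lengths (T + R + (T + R).map (·⁻¹)) := by
      convert hm using 2
      rw [Multiset.map_add]
      abel
    have hk := hL hm'
    simp only [Set.mem_insert_iff, Set.mem_singleton_iff] at hk
    rw [Multiset.card_add] at hX
    rcases hk with hk | hk
    · have : R = 0 := Multiset.card_eq_zero.1 (by omega)
      simp [this]
    · obtain ⟨x, rfl⟩ := exists_eq_pair_of_card_eq_two hat.1 (by omega)
      exact absurd (mul_inv_cancel x) (hpair _ _ hT)
  have hX0 : X ≠ 0 := by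
    rintro rfl
    simp at hX
    omega
  have hsub : ∀ T ≤ X, T ∈ productOne G → T = 0 ∨ T = X := by
    intro T hT hmem
    by_cases h0 : T = 0
    · exact Or.inl h0
    · obtain ⟨A, hA, hat⟩ := exists_atom_le hmem h0
      rw [hatom A (hA.trans hT) hat] at hA
      exact Or.inr (le_antisymm hT hA)
  refine ⟨?_, hX0, hsub⟩
  -- So far X might have no nonempty product-one subsequence at all; having D terms forces one.
  obtain ⟨T, hT, h0, hmem⟩ := exists_le_mem_productOne hX.ge hX0
  rcases hsub T hT hmem with rfl | rfl
  · exact absurd rfl h0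
  · exact hmem

namespace IsMinimalProductOne

variable {X : Multiset G}

/-- Every ordering of a minimal product-one sequence of maximal length has product one. -/
theorem prod_eq_one (h : IsMinimalProductOne X) (hX : X.card = davenport G) {l : List G}
    (hl : (l : Multiset G) = X) : l.prod = 1 := by
  by_contra hne
  -- With D + 1 terms this sequence must split. By minimality the part without the added term is all
  -- of X, so the added term stands alone and must be 1.
  have hmem : (l.prod)⁻¹ ::ₘ X ∈ productOne G := cons_mem_productOne_iff.2 ⟨l, hl, by simp⟩
  have hnot : ¬ IsProductOneAtom ((l.prod)⁻¹ ::ₘ X) := fun hat => by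
    have := hat.card_le
    rw [Multiset.card_cons] at this
    omega
  simp only [IsProductOneAtom, not_and, not_forall, not_or] at hnot
  obtain ⟨A, hA, B, hB, hAB, hA0, hB0⟩ := hnot hmem (Multiset.cons_ne_zero)
  have key : ∀ {A B : Multiset G}, A ∈ productOne G → B ∈ productOne G → B ≠ 0 →
      A + B = (l.prod)⁻¹ ::ₘ X → (l.prod)⁻¹ ∈ A → False := by
    intro A B hA hB hB0 hAB hm
    obtain ⟨A', rfl⟩ := Multiset.exists_cons_of_mem hm
    rw [Multiset.cons_add, Multiset.cons_inj_right] at hAB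
    rcases h.2.2 B (hAB ▸ Multiset.le_add_left B A') hB with rfl | rfl
    · exact hB0 rfl
    · have : A' = 0 := by simpa using hAB
      rw [this, Multiset.cons_zero, singleton_mem_productOne_iff, inv_eq_one] at hA
      exact hne hA
  have hm : (l.prod)⁻¹ ∈ A + B := by
    rw [hAB]
    exact Multiset.mem_cons_self _ _
  rcases Multiset.mem_add.1 hm with hm | hm
  · exact key hA hB hB0 hAB hm
  · exact key hB hA hA0 (by rwa [add_comm]) hm

theorem commute (h : IsMinimalProductOne X) (hX : X.card = davenport G) {x y : G}
    (hx : x ∈ X) (hy : y ∈ X) : x * y = y * x := by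
  classical
  rcases eq_or_ne y x with rfl | hne
  · rfl
  obtain ⟨Y, rfl⟩ := Multiset.exists_cons_of_mem hx
  obtain ⟨Z, rfl⟩ := Multiset.exists_cons_of_mem ((Multiset.mem_cons.1 hy).resolve_left hne)
  obtain ⟨l, rfl⟩ : ∃ l : List G, (l : Multiset G) = Z := Quot.exists_rep Z
  have h1 := h.prod_eq_one hX (l := x :: y :: l) rfl
  have h2 := h.prod_eq_one hX (l := y :: x :: l)
    (Multiset.cons_swap y x (l : Multiset G))
  rw [List.prod_cons, List.prod_cons, ← mul_assoc] at h1 h2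
  exact mul_right_cancel (h1.trans h2.symm)

/-- Replace one term of X by g⁻¹. The new D terms contain a nonempty product-one subsequence; it
uses g⁻¹, since otherwise it would be a proper subsequence of X, and its other terms multiply to g.
-/
theorem exists_prod_eq (h : IsMinimalProductOne X) (hX : X.card = davenport G) (g : G) :
    ∃ l : List G, (l : Multiset G) ≤ X ∧ l.prod = g := by
  obtain ⟨x, hx⟩ := Multiset.exists_mem_of_ne_zero h.2.1
  obtain ⟨Y, rfl⟩ := Multiset.exists_cons_of_mem hx
  obtain ⟨T, hT, hT0, hmem⟩ := exists_le_mem_productOne (Z := g⁻¹ ::ₘ Y)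
    (by rw [← hX, Multiset.card_cons, Multiset.card_cons]) (Multiset.cons_ne_zero)
  by_cases hg : g⁻¹ ∈ T
  · obtain ⟨T', rfl⟩ := Multiset.exists_cons_of_mem hg
    obtain ⟨l, rfl, hl⟩ := cons_mem_productOne_iff.1 hmem
    exact ⟨l, ((Multiset.cons_le_cons_iff _).1 hT).trans (Multiset.le_cons_self Y x),
      (inv_mul_eq_one.1 hl).symm⟩
  · have hTY : T ≤ Y := (Multiset.le_cons_of_notMem hg).1 hT
    rcases h.2.2 T (hTY.trans (Multiset.le_cons_self Y x)) hmem with rfl | rfl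
    · exact absurd rfl hT0
    · have := Multiset.card_le_card hTY
      rw [Multiset.card_cons] at this
      omega

theorem mul_comm_of_card_eq (h : IsMinimalProductOne X) (hX : X.card = davenport G) (a b : G) :
    a * b = b * a := by
  obtain ⟨l, hl, rfl⟩ := h.exists_prod_eq hX a
  obtain ⟨m, hm, rfl⟩ := h.exists_prod_eq hX b
  refine Commute.list_prod_left l _ fun x hx => Commute.list_prod_right m _ fun y hy => ?_
  exact h.commute hX (Multiset.mem_of_le hl (Multiset.mem_coe.2 hx))
    (Multiset.mem_of_le hm (Multiset.mem_coe.2 hy))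

end IsMinimalProductOne

end Minimal

/-! ### Abelian groups: the flipping argument. -/

section Comm

theorem mem_productOne_iff_prod_eq_one {G : Type*} [CommGroup G] {S : Multiset G} :
    S ∈ productOne G ↔ S.prod = 1 := by
  constructor
  · rintro ⟨l, rfl, hl⟩
    simpa using hl
  · intro h
    obtain ⟨l, rfl⟩ : ∃ l : List G, (l : Multiset G) = S := Quot.exists_rep S
    exact ⟨l, rfl, by simpa using h⟩

variable {G : Type*} [CommGroup G]

theorem IsProductOneAtom.isMinimalProductOne {U : Multiset G} (hU : IsProductOneAtom U) :
    IsMinimalProductOne U := by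
  refine ⟨hU.1, hU.2.1, fun T hT hmem => ?_⟩
  obtain ⟨R, rfl⟩ := Multiset.le_iff_exists_add.1 hT
  have hR : R ∈ productOne G := by
    have h1 := mem_productOne_iff_prod_eq_one.1 hU.1
    rw [Multiset.prod_add, mem_productOne_iff_prod_eq_one.1 hmem, one_mul] at h1
    exact mem_productOne_iff_prod_eq_one.2 h1
  rcases hU.2.2 T hmem R hR rfl with h | h
  · exact Or.inl h
  · exact Or.inr (by simp [h])

/-- If a minimal product-one sequence of maximal length stays minimal when all terms `x` are
replaced by `x⁻¹`, and `x` is not an involution, then `x` is its only term. -/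
theorem IsMinimalProductOne.eq_replicate_of_flip [Finite G] {x : G} {a : ℕ} {R : Multiset G}
    (ha : 0 < a) (h : IsMinimalProductOne (Multiset.replicate a x + R))
    (hX : (Multiset.replicate a x + R).card = davenport G)
    (h' : IsMinimalProductOne (Multiset.replicate a x⁻¹ + R)) (hx : x ^ 2 ≠ 1) : R = 0 := by
  by_contra hR0
  obtain ⟨r, hr⟩ := Multiset.exists_mem_of_ne_zero hR0
  obtain ⟨Q, rfl⟩ := Multiset.exists_cons_of_mem hr
  have hp := mem_productOne_iff_prod_eq_one.1 h.1
  have hp' := mem_productOne_iff_prod_eq_one.1 h'.1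
  rw [Multiset.prod_add, Multiset.prod_replicate] at hp hp'
  set ρ := (r ::ₘ Q).prod with hρ
  have h2a : x ^ (2 * a) = 1 := by
    have h1 : x ^ a = x⁻¹ ^ a := mul_right_cancel (hp.trans hp'.symm)
    rw [two_mul, pow_add]
    nth_rewrite 2 [h1]
    rw [inv_pow, mul_inv_cancel]
  have ha2 : 2 ≤ a := by
    by_contra hlt
    have : a = 1 := by omega
    subst this
    exact hx h2a
  rw [Multiset.card_add, Multiset.card_replicate, Multiset.card_cons] at hX
  -- Drop r and raise the multiplicity of x to 2a - 1. Since a ≥ 2, there are still at least D = a +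
  -- |Q| + 1 terms. A product-one subsequence with at most a copies of x would lie properly inside
  -- the original sequence.
  obtain ⟨Z, hZ, hZ0, hmem⟩ := exists_le_mem_productOne
    (Z := Multiset.replicate (2 * a - 1) x + Q)
    (by rw [Multiset.card_add, Multiset.card_replicate]; omega)
    (by
      intro h0
      have := congrArg Multiset.card h0
      rw [Multiset.card_add, Multiset.card_replicate, Multiset.card_zero] at this
      omega)
  obtain ⟨J, T, hJ, hT, rfl⟩ : ∃ J T, J ≤ Multiset.replicate (2 * a - 1) x ∧ T ≤ Q ∧ Z = J + T := by
    classical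
    refine ⟨Z ∩ Multiset.replicate (2 * a - 1) x, Z - Multiset.replicate (2 * a - 1) x,
      Multiset.inter_le_right, by rwa [tsub_le_iff_left], ?_⟩
    rw [add_comm, Multiset.sub_add_inter]
  obtain ⟨j, hj, rfl⟩ := Multiset.le_replicate_iff.1 hJ
  have hjT := mem_productOne_iff_prod_eq_one.1 hmem
  rw [Multiset.prod_add, Multiset.prod_replicate] at hjT
  obtain ⟨V, rfl⟩ := Multiset.le_iff_exists_add.1 hT
  rcases le_or_gt j a with hja | hja
  · rcases h.2.2 _ (add_le_add (Multiset.replicate_mono x hja)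
      (hT.trans (Multiset.le_cons_self _ r))) hmem with h0 | h0
    · exact hZ0 h0
    · have := congrArg Multiset.card h0
      simp only [Multiset.card_add, Multiset.card_replicate, Multiset.card_cons] at this
      omega
  -- Comparing x^j ∏T = 1 with x^a r ∏T ∏V = 1 gives r ∏V = x^(j - a). This is a product-one
  -- subsequence of the flipped sequence, nonempty because of r and proper because j - a < a.
  · have hmem' : Multiset.replicate (j - a) x⁻¹ + r ::ₘ V ∈ productOne G := by
      rw [mem_productOne_iff_prod_eq_one, Multiset.prod_add, Multiset.prod_replicate]
      have h1 : ρ = T.prod * (r ::ₘ V).prod := by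
        rw [hρ, Multiset.prod_cons, Multiset.prod_cons, Multiset.prod_add]
        exact mul_left_comm _ _ _
      have h2 : x ^ j = x ^ (j - a) * x ^ a := by
        rw [← pow_add]
        congr 1
        omega
      rw [h1] at hp
      rw [h2] at hjT
      have h3 : (r ::ₘ V).prod = x ^ (j - a) := by
        have h4 : x ^ a * T.prod = (x ^ (j - a))⁻¹ := by
          rw [eq_inv_iff_mul_eq_one, ← hjT]
          ac_rfl
        rw [← mul_assoc, h4, inv_mul_eq_one] at hp
        exact hp.symm
      rw [h3, inv_pow, inv_mul_cancel]
    have hle : Multiset.replicate (j - a) x⁻¹ + r ::ₘ V ≤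
        Multiset.replicate a x⁻¹ + r ::ₘ (T + V) :=
      add_le_add (Multiset.replicate_mono _ (by omega))
        ((Multiset.cons_le_cons_iff r).2 (Multiset.le_add_left V T))
    rcases h'.2.2 _ hle hmem' with h0 | h0
    · simp at h0
    · have := congrArg Multiset.card h0
      simp only [Multiset.card_add, Multiset.card_replicate, Multiset.card_cons] at this
      omega

/-- Replacing every x by x⁻¹ leaves X + X⁻¹ unchanged, so the flipped sequence meets the same
hypotheses and is minimal as well. -/
theorem exists_eq_replicate_of_lengths_subset [Finite G] {X : Multiset G} (hD : 3 ≤ davenport G)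
    (hX : X.card = davenport G) (h1 : (1 : G) ∉ X)
    (hL : lengths (X + X.map (·⁻¹)) ⊆ {2, davenport G})
    (hpair : ∀ x y, ({x, y} : Multiset G) ≤ X → x * y ≠ 1) {x : G} (hxX : x ∈ X)
    (hx : x ^ 2 ≠ 1) : X = Multiset.replicate (davenport G) x := by
  classical
  have hmin := isMinimalProductOne_of_lengths_subset hD hX h1 hL hpair
  obtain ⟨a, R, ha, hxR, rfl⟩ : ∃ a R, 0 < a ∧ x ∉ R ∧ X = Multiset.replicate a x + R := by
    refine ⟨X.count x, X.filter (fun y => ¬ x = y), Multiset.count_pos.2 hxX, by simp, ?_⟩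
    rw [← Multiset.filter_eq X x, Multiset.filter_add_not]
  have hx' : x⁻¹ ∉ R := by
    intro h
    refine hpair x x⁻¹ ?_ (mul_inv_cancel x)
    rw [Multiset.insert_eq_cons, ← Multiset.singleton_add]
    refine add_le_add (Multiset.singleton_le.2 ?_) (Multiset.singleton_le.2 h)
    exact Multiset.mem_replicate.2 ⟨ha.ne', rfl⟩
  have hne : x⁻¹ ≠ x := fun h => hx (by
    rw [pow_two]
    nth_rewrite 1 [← h]
    simp)
  have hflip : IsMinimalProductOne (Multiset.replicate a x⁻¹ + R) := by
    have heq : Multiset.replicate a x⁻¹ + R + (Multiset.replicate a x⁻¹ + R).map (·⁻¹) =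
        Multiset.replicate a x + R + (Multiset.replicate a x + R).map (·⁻¹) := by
      simp only [Multiset.map_add, Multiset.map_replicate, inv_inv]
      abel
    refine isMinimalProductOne_of_lengths_subset hD ?_ ?_ (by rwa [heq]) ?_
    · simpa using hX
    · simp only [Multiset.mem_add, Multiset.mem_replicate, not_or] at h1 ⊢
      exact ⟨fun h => h1.1 ⟨h.1, by rw [← inv_inv x, ← h.2, inv_one]⟩, h1.2⟩
    · have hxn : x ∉ Multiset.replicate a x⁻¹ + R := by
        simp only [Multiset.mem_add, Multiset.mem_replicate, not_or]
        exact ⟨fun h => hne h.2.symm, hxR⟩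
      intro u v huv huv1
      have hu : u ∈ Multiset.replicate a x⁻¹ + R := Multiset.mem_of_le huv (by simp)
      have hv : v ∈ Multiset.replicate a x⁻¹ + R := Multiset.mem_of_le huv (by simp)
      have hux : u ≠ x⁻¹ := by
        rintro rfl
        rw [inv_mul_eq_one] at huv1
        exact hxn (huv1 ▸ hv)
      have hvx : v ≠ x⁻¹ := by
        rintro rfl
        rw [mul_inv_eq_one] at huv1
        exact hxn (huv1 ▸ hu)
      refine hpair u v ?_ huv1
      refine le_trans ?_ (Multiset.le_add_left R (Multiset.replicate a x))
      have h3 := Multiset.filter_le_filter (fun y => y ≠ x⁻¹) huv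
      rw [Multiset.filter_add, (Multiset.filter_eq_self (s := {u, v})).2,
        Multiset.filter_eq_nil.2, zero_add] at h3
      · exact h3.trans (Multiset.filter_le _ _)
      · intro b hb
        simpa using Multiset.eq_of_mem_replicate hb
      · intro b hb
        simp only [Multiset.insert_eq_cons, Multiset.mem_cons, Multiset.mem_singleton] at hb
        rcases hb with rfl | rfl
        · exact hux
        · exact hvx
  have hR := hmin.eq_replicate_of_flip ha hX hflip hx
  subst hR
  rw [add_zero, Multiset.card_replicate] at hX
  rw [hX, add_zero]

theorem orderOf_eq_of_isMinimalProductOne_replicate {x : G} {m : ℕ}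
    (h : IsMinimalProductOne (Multiset.replicate m x)) : orderOf x = m := by
  have hm : 0 < m := Nat.pos_of_ne_zero fun h0 => h.2.1 (by simp [h0])
  rw [orderOf_eq_iff hm]
  refine ⟨by simpa using mem_productOne_iff_prod_eq_one.1 h.1, fun j hj hj0 hpow => ?_⟩
  rcases h.2.2 (Multiset.replicate j x) (Multiset.replicate_mono x hj.le)
    (mem_productOne_iff_prod_eq_one.2 (by simpa using hpow)) with h0 | h0
  all_goals
    have := congrArg Multiset.card h0
    simp only [Multiset.card_replicate, Multiset.card_zero] at this
    omega

theorem card_eq_of_isMinimalProductOne_replicate [Finite G] {x : G}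
    (h : IsMinimalProductOne (Multiset.replicate (davenport G) x)) :
    IsCyclic G ∧ Nat.card G = davenport G := by
  have hgen : ∀ g : G, g ∈ Subgroup.zpowers x := by
    intro g
    obtain ⟨l, hl, rfl⟩ := h.exists_prod_eq (by simp) g
    refine Subgroup.list_prod_mem _ fun y hy => ?_
    rw [Multiset.eq_of_mem_replicate (Multiset.mem_of_le hl (Multiset.mem_coe.2 hy))]
    exact Subgroup.mem_zpowers x
  exact ⟨⟨x, hgen⟩, by
    rw [← orderOf_eq_of_isMinimalProductOne_replicate h, orderOf_eq_card_of_forall_mem_zpowers hgen]⟩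

end Comm

theorem card_sum_eq_mul_card {α : Type*} {s : Multiset (Multiset α)} {c : ℕ}
    (hs : ∀ u ∈ s, u.card = c) : s.sum.card = s.card * c := by
  induction s using Multiset.induction_on with
  | empty => simp
  | cons a s ih =>
    rw [Multiset.sum_cons, Multiset.card_add, Multiset.card_cons,
      ih fun u hu => hs u (Multiset.mem_cons_of_mem hu), hs a (Multiset.mem_cons_self a s)]
    ring

theorem IsProductOneAtom.subset_lengths {G : Type*} [Group G] {U : Multiset G}
    (hU : IsProductOneAtom U) (h1 : (1 : G) ∉ U) :
    {2, U.card} ⊆ lengths (U + U.map (·⁻¹)) := by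
  rintro k (rfl | rfl)
  · exact two_mem_lengths_iff.2 ⟨U, _, hU, hU.map_inv, rfl⟩
  · exact card_mem_lengths_add_map_inv h1

/-! ### Abelian groups: maximality of {2, D}. -/

section CommLengths

variable {G : Type*} [CommGroup G]

/-- A pair a, a is product-one, so an atom that is not a pair has no repeated term. Inside U + U it
then lies in U and equals U by minimality, and what remains is the single atom U. -/
theorem lengths_eq_of_nodup {U : Multiset G} (hU : IsProductOneAtom U) (h1 : (1 : G) ∉ U)
    (hexp : ∀ g : G, g ^ 2 = 1) (hnd : U.Nodup) : lengths (U + U) = {2, U.card} := by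
  classical
  have hinv : U.map (·⁻¹) = U := by
    conv_rhs => rw [← Multiset.map_id U]
    exact Multiset.map_congr rfl fun g _ => inv_eq_of_mul_eq_one_right (by rw [id, ← pow_two, hexp])
  refine Set.Subset.antisymm ?_ (by simpa only [hinv] using hU.subset_lengths h1)
  rintro k ⟨s, hs, rfl, hsum⟩
  have hle : ∀ u ∈ s, u ≤ U + U := fun u hu => hsum ▸ Multiset.le_sum_of_mem hu
  by_cases h : ∀ u ∈ s, u.card = 2
  · have := card_sum_eq_mul_card h
    rw [hsum, Multiset.card_add] at this
    right
    change s.card = U.card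
    omega
  · left
    push Not at h
    obtain ⟨u, hu, hu2⟩ := h
    have hund : u.Nodup := by
      rw [Multiset.nodup_iff_le]
      intro a ha
      rcases (hs u hu).isMinimalProductOne.2.2 _ ha
        (mem_productOne_iff_prod_eq_one.2 (by simpa [pow_two] using hexp a)) with h | h
      · simp at h
      · rw [← h] at hu2
        simp at hu2
    have huU : u ≤ U := by
      rw [Multiset.le_iff_subset hund]
      intro a ha
      have := Multiset.mem_of_le (hle u hu) ha
      simpa using this
    obtain rfl : u = U := (hU.isMinimalProductOne.2.2 u huU (hs u hu).1).resolve_left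
      (hs u hu).2.1
    obtain ⟨t, rfl⟩ := Multiset.exists_cons_of_mem hu
    rw [Multiset.sum_cons, add_right_inj] at hsum
    rw [Multiset.card_cons, hU.eq_one_of_mem_lengths
      ⟨t, fun v hv => hs v (Multiset.mem_cons_of_mem hv), rfl, hsum⟩]

theorem IsProductOneAtom.eq_replicate_orderOf [Finite G] {u : Multiset G} {x : G}
    (hu : IsProductOneAtom u) (hx : ∀ y ∈ u, y = x) : u = Multiset.replicate (orderOf x) x := by
  have h := Multiset.eq_replicate_card.2 hx
  have hpow : x ^ u.card = 1 := by
    have := mem_productOne_iff_prod_eq_one.1 hu.1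
    rwa [h, Multiset.prod_replicate] at this
  have hle : Multiset.replicate (orderOf x) x ≤ u := by
    rw [h]
    exact Multiset.replicate_mono x (Nat.le_of_dvd (Multiset.card_pos.2 hu.2.1)
      (orderOf_dvd_of_pow_eq_one hpow))
  rcases hu.isMinimalProductOne.2.2 _ hle (isProductOneAtom_replicate_orderOf x).1 with h0 | h0
  · exact absurd h0 (isProductOneAtom_replicate_orderOf x).2.1
  · exact h0.symm

/-- The only atoms available are the pair x, x⁻¹ and the two constant ones. Once a constant atom is
used, the rest is the other constant atom. -/
theorem lengths_replicate_orderOf [Finite G] {x : G} (hx : 3 ≤ orderOf x) :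
    lengths (Multiset.replicate (orderOf x) x + (Multiset.replicate (orderOf x) x).map (·⁻¹)) =
      {2, orderOf x} := by
  have hU := isProductOneAtom_replicate_orderOf x
  have hV := isProductOneAtom_replicate_orderOf x⁻¹
  have h1 : (1 : G) ∉ Multiset.replicate (orderOf x) x := fun h => by
    rw [← Multiset.eq_of_mem_replicate h, orderOf_one] at hx
    omega
  refine Set.Subset.antisymm ?_ (by simpa using hU.subset_lengths h1)
  rw [Multiset.map_replicate]
  rintro k ⟨s, hs, rfl, hsum⟩
  rw [orderOf_inv] at hV
  have hne : x⁻¹ ≠ x := fun h => by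
    have h2 : x ^ 2 = 1 := by
      rw [pow_two]
      nth_rewrite 1 [← h]
      simp
    have := Nat.le_of_dvd two_pos (orderOf_dvd_of_pow_eq_one h2)
    omega
  have hcases : ∀ u ∈ s, u.card = 2 ∨ u = Multiset.replicate (orderOf x) x ∨
      u = Multiset.replicate (orderOf x) x⁻¹ := by
    intro u hu
    have hmem : ∀ y ∈ u, y = x ∨ y = x⁻¹ := fun y hy => by
      have : y ∈ s.sum := mem_multiset_sum_iff.2 ⟨u, hu, hy⟩
      rw [hsum, Multiset.mem_add] at this
      exact this.imp Multiset.eq_of_mem_replicate Multiset.eq_of_mem_replicate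
    by_cases hxu : x ∈ u
    · by_cases hxu' : x⁻¹ ∈ u
      · left
        obtain ⟨v, rfl⟩ := Multiset.exists_cons_of_mem hxu
        have hle : ({x, x⁻¹} : Multiset G) ≤ x ::ₘ v := by
          rw [Multiset.insert_eq_cons, Multiset.cons_le_cons_iff, Multiset.singleton_le]
          exact (Multiset.mem_cons.1 hxu').resolve_left hne
        rcases (hs _ hu).isMinimalProductOne.2.2 _ hle
          (pair_mem_productOne_iff.2 (mul_inv_cancel x)) with h | h
        · simp at h
        · rw [← h, Multiset.card_pair]
      · exact Or.inr (Or.inl ((hs u hu).eq_replicate_orderOf fun y hy =>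
          (hmem y hy).resolve_right (by rintro rfl; exact hxu' hy)))
    · refine Or.inr (Or.inr ?_)
      rw [← orderOf_inv]
      exact (hs u hu).eq_replicate_orderOf fun y hy =>
          (hmem y hy).resolve_left (by rintro rfl; exact hxu hy)
  by_cases h : ∀ u ∈ s, u.card = 2
  · have := card_sum_eq_mul_card h
    rw [hsum, Multiset.card_add, Multiset.card_replicate, Multiset.card_replicate] at this
    right
    change s.card = orderOf x
    omega
  · left
    push Not at h
    obtain ⟨u, hu, hu2⟩ := h
    obtain ⟨t, rfl⟩ := Multiset.exists_cons_of_mem hu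
    have key : ∀ W : Multiset G, IsProductOneAtom W → t.sum = W → (u ::ₘ t).card = 2 := by
      intro W hW htW
      rw [Multiset.card_cons, hW.eq_one_of_mem_lengths
        ⟨t, fun v hv => hs v (Multiset.mem_cons_of_mem hv), rfl, htW⟩]
    rw [Multiset.sum_cons] at hsum
    rcases hcases u hu with h | rfl | rfl
    · exact absurd h hu2
    · exact key _ hV (by simpa using hsum)
    · rw [add_comm, add_left_inj] at hsum
      exact key _ hU hsum

/-- In a finite abelian group, an atom whose length is the order of the group has a single
distinct term. -/
theorem IsProductOneAtom.eq_replicate_of_card_eq [Finite G] {U : Multiset G}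
    (hU : IsProductOneAtom U) (hc : U.card = Nat.card G) (h1 : (1 : G) ∉ U) {g : G} (hg : g ∈ U) :
    U = Multiset.replicate U.card g := by
  rw [Multiset.eq_replicate_card]
  intro h hh
  by_contra hne
  obtain ⟨Y, rfl⟩ := Multiset.exists_cons_of_mem hg
  obtain ⟨Z, rfl⟩ := Multiset.exists_cons_of_mem ((Multiset.mem_cons.1 hh).resolve_left hne)
  obtain ⟨l, rfl⟩ : ∃ l : List G, (l : Multiset G) = Z := Quot.exists_rep Z
  have hmin := hU.isMinimalProductOne.2.2
  set L : List G := g :: h :: l with hL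
  have hLc : L.length = Nat.card G := by
    rw [← hc]
    simp [hL]
  have hfree : ∀ m : List G, m.Sublist L → m.length < L.length → m.prod = 1 → m = [] := by
    intro m hm hlen hp
    have hmL : (m : Multiset G) ≤ (L : Multiset G) := Multiset.coe_le.2 hm.subperm
    rcases hmin (m : Multiset G) hmL ⟨m, rfl, hp⟩ with h0 | h0
    · simpa using h0
    · have := congrArg Multiset.card h0
      simp only [Multiset.coe_card, Multiset.card_cons] at this
      simp only [hL, List.length_cons] at hlen
      omega
  -- Equal partial products would cut out a nonempty proper product-one subsequence. So the |G|
  -- partial products, the empty one included, run through G.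
  have hinj : Function.Injective fun i : Fin L.length => (L.take i).prod := by
    intro i j hij
    wlog hlt : i < j generalizing i j
    · by_contra hn
      exact hn (this hij.symm (lt_of_le_of_ne (not_lt.1 hlt) (Ne.symm hn))).symm
    exfalso
    have hsplit : (L.take j) = L.take i ++ (L.take j).drop i := by
      conv_lhs => rw [← List.take_append_drop i (L.take j)]
      rw [List.take_take, min_eq_left (Fin.lt_def.1 hlt).le]
    have hp : ((L.take j).drop i).prod = 1 := by
      have hij' : (L.take i).prod = (L.take j).prod := hij
      rw [hsplit, List.prod_append] at hij'
      exact mul_eq_left.1 hij'.symm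
    have hj := j.2
    have hlen : ((L.take j).drop i).length = j - i := by
      rw [List.length_drop, List.length_take, min_eq_left hj.le]
    have := hfree _ ((List.drop_sublist _ _).trans (List.take_sublist _ _))
      (by rw [hlen]; omega) hp
    rw [this, List.length_nil] at hlen
    have := Fin.lt_def.1 hlt
    omega
  have hsurj : Function.Surjective fun i : Fin L.length => (L.take i).prod :=
    ((Nat.bijective_iff_injective_and_card _).2 ⟨hinj, by simpa using hLc⟩).2
  -- The second term h is itself a partial product. As h is neither 1 nor g, the prefix contains
  -- both g and h; cancelling h leaves a nonempty proper product-one subsequence.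
  obtain ⟨⟨i, hi⟩, hprod⟩ := hsurj h
  simp only [hL] at hprod hi
  have hh1 : h ≠ 1 := fun h0 => h1 (h0 ▸ hh)
  match i, hprod, hi with
  | 0, hprod, _ => exact hh1 (by simpa using hprod.symm)
  | 1, hprod, _ => exact hne (by simpa using hprod.symm)
  | i + 2, hprod, hi =>
    simp only [List.take_succ_cons, List.prod_cons] at hprod
    have hp : (g :: l.take i).prod = 1 := by
      rw [mul_left_comm] at hprod
      rw [List.prod_cons]
      exact mul_eq_left.1 hprod
    have := hfree (g :: l.take i)
      (List.Sublist.cons_cons g ((List.take_sublist i l).trans (List.sublist_cons_self h l)))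
      (by simp [hL]) hp
    simp at this

/-- Atoms with at least three terms contain no product-one pair: at most one of g, g⁻¹ occurs, and
only once if g = g⁻¹. In X + X⁻¹ the multiplicities of g and g⁻¹ agree, and they are even if g =
g⁻¹; this determines V from U. -/
theorem eq_map_inv_of_add_eq {U V X : Multiset G} (hU : IsProductOneAtom U)
    (hV : IsProductOneAtom V) (hcU : 3 ≤ U.card) (hcV : 3 ≤ V.card)
    (h : U + V = X + X.map (·⁻¹)) : V = U.map (·⁻¹) := by
  classical
  have hinv : ∀ (Y : Multiset G) (g : G), (Y.map (·⁻¹)).count g = Y.count g⁻¹ := fun Y g => by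
    rw [← inv_inv g, Multiset.count_map_eq_count' _ _ inv_injective, inv_inv]
  have hpair : ∀ W : Multiset G, IsProductOneAtom W → 3 ≤ W.card → ∀ g : G,
      ¬ ({g, g⁻¹} : Multiset G) ≤ W := by
    intro W hW hc g hle
    rcases hW.isMinimalProductOne.2.2 _ hle
      (pair_mem_productOne_iff.2 (mul_inv_cancel g)) with h | h
    · simp at h
    · rw [← h, Multiset.card_pair] at hc
      omega
  have hzero : ∀ W : Multiset G, IsProductOneAtom W → 3 ≤ W.card → ∀ g : G, g⁻¹ ≠ g →
      W.count g = 0 ∨ W.count g⁻¹ = 0 := by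
    intro W hW hc g hg
    by_contra! hn
    refine hpair W hW hc g ?_
    obtain ⟨W', rfl⟩ := Multiset.exists_cons_of_mem (Multiset.count_ne_zero.1 hn.1)
    rw [Multiset.insert_eq_cons, Multiset.cons_le_cons_iff, Multiset.singleton_le]
    exact (Multiset.mem_cons.1 (Multiset.count_ne_zero.1 hn.2)).resolve_left hg
  have hone : ∀ W : Multiset G, IsProductOneAtom W → 3 ≤ W.card → ∀ g : G, g⁻¹ = g →
      W.count g ≤ 1 := by
    intro W hW hc g hg
    by_contra! hn
    refine hpair W hW hc g ?_
    rw [hg]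
    exact Multiset.le_count_iff_replicate_le.1 hn
  ext g
  rw [hinv]
  have e1 := congrArg (Multiset.count g) h
  have e2 := congrArg (Multiset.count g⁻¹) h
  rw [Multiset.count_add, Multiset.count_add, hinv] at e1 e2
  rw [inv_inv] at e2
  by_cases hg : g⁻¹ = g
  · rw [hg] at e1 ⊢
    have := hone U hU hcU g hg
    have := hone V hV hcV g hg
    omega
  · have := hzero U hU hcU g hg
    have := hzero V hV hcV g hg
    omega

theorem IsProductOneAtom.mul_ne_one_of_le {U : Multiset G} (hU : IsProductOneAtom U)
    (hc : 3 ≤ U.card) {x y : G} (h : ({x, y} : Multiset G) ≤ U) : x * y ≠ 1 := by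
  intro hxy
  rcases hU.isMinimalProductOne.2.2 _ h (pair_mem_productOne_iff.2 hxy) with h | h
  · simp at h
  · rw [← h, Multiset.card_pair] at hc
    omega

theorem exists_atom_of_subset_lengths [Finite G] {S : Multiset G} (hD : 3 ≤ davenport G)
    (h : {2, davenport G} ⊆ lengths S) : ∃ U : Multiset G, IsProductOneAtom U ∧ (1 : G) ∉ U ∧
      U.card = davenport G ∧ S = U + U.map (·⁻¹) := by
  obtain ⟨h1, U, V, X, hU, hV, hcU, hcV, -, rfl, hS⟩ :=
    exists_of_two_davenport_mem_lengths hD (h (by simp)) (h (by simp))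
  refine ⟨U, hU, fun h => h1 (Multiset.mem_add.2 (Or.inl h)), hcU, ?_⟩
  rw [eq_map_inv_of_add_eq hU hV (by omega) (by omega) hS]

/-- If `{2, D(G)}` is a set of lengths of a finite abelian group `G`, then it is maximal. -/
theorem eq_of_subset_of_mem_systemOfLengths [Finite G] (hD : 3 ≤ davenport G)
    (hmem : {2, davenport G} ∈ systemOfLengths G) {L : Set ℕ} (hL : L ∈ systemOfLengths G)
    (hsub : {2, davenport G} ⊆ L) : L = {2, davenport G} := by
  classical
  obtain ⟨S, -, hS⟩ := mem_systemOfLengths_iff.1 hmem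
  obtain ⟨U, hU, h1U, hcU, rfl⟩ := exists_atom_of_subset_lengths hD hS.ge
  obtain ⟨T, -, rfl⟩ := mem_systemOfLengths_iff.1 hL
  obtain ⟨V, hV, h1V, hcV, rfl⟩ := exists_atom_of_subset_lengths hD hsub
  by_cases hinv : ∀ x ∈ U, x ^ 2 = 1
  · have hexp : ∀ g : G, g ^ 2 = 1 := by
      intro g
      obtain ⟨l, hl, rfl⟩ := hU.isMinimalProductOne.exists_prod_eq hcU g
      have hl' : ∀ x ∈ l, x ^ 2 = 1 := fun x hx =>
        hinv x (Multiset.mem_of_le hl (Multiset.mem_coe.2 hx))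
      rw [← powMonoidHom_apply, map_list_prod, List.prod_eq_one]
      intro y hy
      obtain ⟨x, hx, rfl⟩ := List.mem_map.1 hy
      exact hl' x hx
    have hVinv : V.map (·⁻¹) = V := by
      conv_rhs => rw [← Multiset.map_id V]
      exact Multiset.map_congr rfl fun g _ =>
        inv_eq_of_mul_eq_one_right (by rw [id, ← pow_two, hexp])
    rw [hVinv, ← hcV]
    refine lengths_eq_of_nodup hV h1V hexp (Multiset.nodup_iff_le.2 fun a ha => ?_)
    exact hV.mul_ne_one_of_le (by omega) (x := a) (y := a) ha (by rw [← pow_two, hexp])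
  · push Not at hinv
    obtain ⟨x, hxU, hx⟩ := hinv
    have hrep := exists_eq_replicate_of_lengths_subset hD hcU h1U hS.le
      (fun x y h => hU.mul_ne_one_of_le (by omega) h) hxU hx
    rw [hrep] at hU
    obtain ⟨-, hcard⟩ := card_eq_of_isMinimalProductOne_replicate hU.isMinimalProductOne
    obtain ⟨g, hg⟩ := Multiset.exists_mem_of_ne_zero hV.2.1
    have hVrep := hV.eq_replicate_of_card_eq (hcV.trans hcard.symm) h1V hg
    rw [hcV] at hVrep
    rw [hVrep] at hV ⊢
    have hord := orderOf_eq_of_isMinimalProductOne_replicate hV.isMinimalProductOne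
    rw [← hord]
    exact lengths_replicate_orderOf (by omega)

theorem two_davenport_mem_of_isCyclic [Finite G] [IsCyclic G] (h3 : 3 ≤ Nat.card G) :
    davenport G = Nat.card G ∧ {2, davenport G} ∈ systemOfLengths G := by
  obtain ⟨x, hx⟩ := IsCyclic.exists_generator (α := G)
  have hord := orderOf_eq_card_of_forall_mem_zpowers hx
  have hD : davenport G = Nat.card G :=
    le_antisymm davenport_le_card (hord ▸ orderOf_le_davenport x)
  refine ⟨hD, ?_⟩
  have hl := lengths_replicate_orderOf (x := x) (by omega)
  rw [hord, ← hD] at hl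
  exact mem_systemOfLengths_iff.2
    ⟨_, mem_productOne_of_mem_lengths (k := 2) (by rw [hl]; simp), hl⟩

end CommLengths

/-! ### Groups of odd order. -/

section OddOrder

variable {G : Type*} [Group G] [Finite G]

theorem three_le_davenport_of_odd (h3 : 3 ≤ Nat.card G) (hodd : Odd (Nat.card G)) :
    3 ≤ davenport G := by
  have : Nontrivial G := Finite.one_lt_card_iff_nontrivial.1 (by omega)
  obtain ⟨x, hx⟩ := exists_ne (1 : G)
  have hox : Odd (orderOf x) := hodd.of_dvd_nat (orderOf_dvd_natCard x)
  have h1 : orderOf x ≠ 1 := fun h => hx (orderOf_eq_one_iff.1 h)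
  have := orderOf_le_davenport x
  obtain ⟨m, hm⟩ := hox
  omega

theorem isCyclic_of_two_davenport_mem (h3 : 3 ≤ Nat.card G) (hodd : Odd (Nat.card G))
    (hmem : {2, davenport G} ∈ systemOfLengths G) : IsCyclic G ∧ Nat.card G = davenport G := by
  have hD := three_le_davenport_of_odd h3 hodd
  obtain ⟨S, -, hS⟩ := mem_systemOfLengths_iff.1 hmem
  obtain ⟨h1, -, -, X, -, -, -, -, hX, -, rfl⟩ := exists_of_two_davenport_mem_lengths hD
    (S := S) (by rw [hS]; simp) (by rw [hS]; simp)
  obtain ⟨Y, hY, hYX, hpair⟩ := exists_orientation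
    (fun h => h1 (Multiset.mem_add.2 (Or.inl h))) hodd
  rw [← hYX] at hS h1
  rw [hX] at hY
  have h1Y : (1 : G) ∉ Y := fun h => h1 (Multiset.mem_add.2 (Or.inl h))
  have hmin := isMinimalProductOne_of_lengths_subset hD hY h1Y hS.le hpair
  -- Minimality at length D forces commutativity, which opens the way to the flipping argument.
  let _ : CommGroup G := { ‹Group G› with mul_comm := hmin.mul_comm_of_card_eq hY }
  obtain ⟨x, hx⟩ := Multiset.exists_mem_of_ne_zero hmin.2.1
  have hx2 : x ^ 2 ≠ 1 := fun h => by
    have h2 := orderOf_dvd_of_pow_eq_one h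
    have h5 : Odd (orderOf x) := hodd.of_dvd_nat (orderOf_dvd_natCard _)
    rcases (Nat.dvd_prime Nat.prime_two).1 h2 with h | h
    · rw [orderOf_eq_one_iff] at h
      exact h1Y (h ▸ hx)
    · rw [h] at h5
      exact absurd h5 (by decide)
  have hrep := exists_eq_replicate_of_lengths_subset hD hY h1Y hS.le hpair hx hx2
  rw [hrep] at hmin
  exact card_eq_of_isMinimalProductOne_replicate hmin

theorem two_davenport_mem_iff (h3 : 3 ≤ Nat.card G) (hodd : Odd (Nat.card G)) :
    {2, davenport G} ∈ systemOfLengths G ↔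
      Nonempty (G ≃* Multiplicative (ZMod (davenport G))) := by
  constructor
  · intro h
    obtain ⟨hc, hcard⟩ := isCyclic_of_two_davenport_mem h3 hodd h
    rw [← hcard]
    exact ⟨(zmodCyclicMulEquiv hc).symm⟩
  · rintro ⟨e⟩
    have hc : IsCyclic G := isCyclic_of_surjective e.symm e.symm.surjective
    let _ : CommGroup G := IsCyclic.commGroup
    exact (two_davenport_mem_of_isCyclic h3).2

theorem nonempty_mulEquiv_of_systemOfLengths_eq {H : Type*} [Group H] [Finite H]
    (h3 : 3 ≤ Nat.card G) (hodd : Odd (Nat.card G)) (hc : IsCyclic H)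
    (h : systemOfLengths H = systemOfLengths G) : Nonempty (H ≃* G) := by
  have hD := davenport_eq_of_systemOfLengths_eq h.symm (three_le_davenport_of_odd h3 hodd)
  have hle := davenport_le_card (G := H)
  have hG3 := three_le_davenport_of_odd h3 hodd
  let _ : CommGroup H := IsCyclic.commGroup
  obtain ⟨hH, hmem⟩ := two_davenport_mem_of_isCyclic (G := H) (by omega)
  rw [h, ← hD] at hmem
  obtain ⟨hcG, hcard⟩ := isCyclic_of_two_davenport_mem h3 hodd hmem
  exact ⟨mulEquivOfCyclicCardEq (by omega)⟩

end OddOrder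

theorem eq_replicate_add_replicate {α : Type*} [DecidableEq α] {x y : α} (hxy : x ≠ y)
    {T : Multiset α} (hT : ∀ z ∈ T, z = x ∨ z = y) :
    T = Multiset.replicate (T.count x) x + Multiset.replicate (T.count y) y := by
  ext z
  rw [Multiset.count_add, Multiset.count_replicate, Multiset.count_replicate]
  by_cases hx : x = z
  · subst hx
    simp [hxy.symm]
  · by_cases hy : y = z
    · subst hy
      simp [hxy]
    · rw [if_neg hx, if_neg hy, Multiset.count_eq_zero]
      intro hz
      rcases hT z hz with rfl | rfl
      · exact hx rfl
      · exact hy rfl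

theorem replicate_two_mul_mem_productOne {G : Type*} [Group G] {x : G} (hx : x * x = 1) (k : ℕ) :
    Multiset.replicate (2 * k) x ∈ productOne G :=
  ⟨List.replicate (2 * k) x, Multiset.coe_replicate _ _, by
    rw [List.prod_replicate, pow_mul, pow_two, hx, one_pow]⟩

theorem count_sum_even {α : Type*} [DecidableEq α] {x : α} {s : Multiset (Multiset α)}
    (hs : ∀ u ∈ s, u.count x % 2 = 0) : s.sum.count x % 2 = 0 := by
  induction s using Multiset.induction_on with
  | empty => simp
  | cons a s ih =>
    rw [Multiset.sum_cons, Multiset.count_add]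
    have := ih fun u hu => hs u (Multiset.mem_cons_of_mem hu)
    have := hs a (Multiset.mem_cons_self a s)
    omega

/-! ### Dihedral groups: the atom made of two reflections. -/

namespace DihedralGroup

variable {n : ℕ}

theorem dvd_of_r_eq_one {t : ℤ} (h : r (t : ZMod n) = 1) : (n : ℤ) ∣ t := by
  rw [one_def, r.injEq] at h
  exact (ZMod.intCast_zmod_eq_zero_iff_dvd t n).1 h

theorem le_abs_of_dvd_of_odd {t : ℤ} (h : (n : ℤ) ∣ t) (ht : t % 2 = 1) :
    (n : ℤ) ≤ t ∨ (n : ℤ) ≤ -t := by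
  have h1 : (n : ℤ) ≤ |t| := Int.le_of_dvd (abs_pos.2 (by omega)) ((dvd_abs _ _).2 h)
  rcases abs_choice t with h2 | h2 <;> rw [h2] at h1
  · exact Or.inl h1
  · exact Or.inr h1

theorem sr_zero_ne_sr_one (hn : 2 ≤ n) : (sr 0 : DihedralGroup n) ≠ sr 1 := by
  have : Fact (1 < n) := ⟨hn⟩
  intro h
  rw [sr.injEq] at h
  exact zero_ne_one h

/-- The possible products of a list with terms `sr 0` and `sr 1`. -/
theorem prod_list_sr (hn : 2 ≤ n) (l : List (DihedralGroup n))
    (hl : ∀ x ∈ l, x = sr 0 ∨ x = sr 1) :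
    ∃ t : ℤ, (t - l.count (sr 1)) % 2 = 0 ∧ t ≤ l.count (sr 1) ∧ -t ≤ l.count (sr 1) ∧
      (((l.count (sr 0) + l.count (sr 1)) % 2 = 0 ∧ l.prod = r t ∧
          t ≤ l.count (sr 0) ∧ -t ≤ l.count (sr 0)) ∨
        ((l.count (sr 0) + l.count (sr 1)) % 2 = 1 ∧ l.prod = sr t ∧
          t ≤ l.count (sr 0) + 1 ∧ -t + 1 ≤ l.count (sr 0))) := by
  have hne := sr_zero_ne_sr_one hn
  -- The exponent is tracked in ℤ because residues modulo an odd n carry no parity. For products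
  -- that are reflections, the count of `sr 0` bounds |t - 1|, the distance from `sr 1`.
  induction l with
  | nil => exact ⟨0, by simp⟩
  | cons x l ih =>
    obtain ⟨t, h1, h2, h3, h4⟩ := ih fun y hy => hl y (List.mem_cons_of_mem x hy)
    rcases hl x List.mem_cons_self with rfl | rfl
    · simp only [List.count_cons_self, List.count_cons_of_ne hne, List.prod_cons]
      rcases h4 with ⟨h5, h6, h7⟩ | ⟨h5, h6, h7⟩
      · exact ⟨t, h1, h2, h3, Or.inr ⟨by omega, by rw [h6, sr_mul_r, zero_add], by omega, by omega⟩⟩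
      · exact ⟨t, h1, h2, h3, Or.inl ⟨by omega, by rw [h6, sr_mul_sr, sub_zero], by omega, by omega⟩⟩
    · simp only [List.count_cons_self, List.count_cons_of_ne hne.symm, List.prod_cons]
      rcases h4 with ⟨h5, h6, h7⟩ | ⟨h5, h6, h7⟩
      · refine ⟨t + 1, by omega, by omega, by omega, Or.inr ⟨by omega, ?_, by omega, by omega⟩⟩
        rw [h6, sr_mul_r]
        push_cast
        rw [add_comm]
      · refine ⟨t - 1, by omega, by omega, by omega, Or.inl ⟨by omega, ?_, by omega, by omega⟩⟩
        rw [h6, sr_mul_sr]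
        push_cast
        rfl

/-- If the count of `sr 1` is odd, so is the exponent t. Being a nonzero multiple of n, it satisfies
|t| ≥ n, while both counts bound |t|. -/
theorem count_of_mem_productOne (hn : 2 ≤ n) {T : Multiset (DihedralGroup n)}
    (hT : T ∈ productOne (DihedralGroup n)) (hsupp : ∀ x ∈ T, x = sr 0 ∨ x = sr 1) :
    (T.count (sr 0) % 2 = 0 ∧ T.count (sr 1) % 2 = 0) ∨
      (T.count (sr 0) % 2 = 1 ∧ T.count (sr 1) % 2 = 1 ∧
        n ≤ T.count (sr 0) ∧ n ≤ T.count (sr 1)) := by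
  obtain ⟨l, rfl, hl⟩ := hT
  simp only [Multiset.coe_count]
  obtain ⟨t, h1, h2, h3, h4⟩ := prod_list_sr hn l fun x hx => hsupp x (Multiset.mem_coe.2 hx)
  rcases h4 with ⟨h5, h6, h7⟩ | ⟨h5, h6, h7⟩
  · rcases Nat.mod_two_eq_zero_or_one (l.count (sr 1)) with h | h
    · left
      omega
    · right
      rw [hl] at h6
      have := le_abs_of_dvd_of_odd (dvd_of_r_eq_one h6.symm) (by omega)
      omega
  · rw [hl, one_def] at h6
    cases h6

theorem card_eq_two_of_count_even (hn : 2 ≤ n) {T : Multiset (DihedralGroup n)}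
    (hT : IsProductOneAtom T) (hsupp : ∀ x ∈ T, x = sr 0 ∨ x = sr 1)
    (h0 : T.count (sr 0) % 2 = 0) (h1 : T.count (sr 1) % 2 = 0) : T.card = 2 := by
  have heq := eq_replicate_add_replicate (sr_zero_ne_sr_one hn) hsupp
  generalize T.count (sr 0) = a at *
  generalize T.count (sr 1) = b at *
  obtain ⟨i, rfl⟩ := Nat.dvd_of_mod_eq_zero h0
  obtain ⟨j, rfl⟩ := Nat.dvd_of_mod_eq_zero h1
  have hmem : ∀ i j : ℕ, (Multiset.replicate (2 * i) (sr 0) + Multiset.replicate (2 * j) (sr 1)) ∈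
      productOne (DihedralGroup n) := fun i j =>
    add_mem (replicate_two_mul_mem_productOne (sr_mul_self 0) i)
      (replicate_two_mul_mem_productOne (sr_mul_self 1) j)
  rcases Nat.eq_zero_or_pos i with rfl | hi
  · rcases Nat.eq_zero_or_pos j with rfl | hj
    · exact absurd (by simpa using heq) hT.2.1
    · obtain ⟨j, rfl⟩ := Nat.exists_eq_add_of_le' hj
      rcases hT.2.2 _ (hmem 0 j) _ (hmem 0 1) (by
        rw [heq, mul_add, Multiset.replicate_add]
        simp) with h | h
      · rw [heq, Multiset.card_add]
        have := congrArg Multiset.card h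
        simp only [Multiset.card_add, Multiset.card_replicate, Multiset.card_zero] at this ⊢
        omega
      · simpa using congrArg Multiset.card h
  · obtain ⟨i, rfl⟩ := Nat.exists_eq_add_of_le' hi
    rcases hT.2.2 _ (hmem i j) _ (hmem 1 0) (by
        rw [heq, mul_add, Multiset.replicate_add]
        simp only [mul_one, mul_zero, Multiset.replicate_zero, add_zero]
        abel) with h | h
    · rw [heq, Multiset.card_add]
      have := congrArg Multiset.card h
      simp only [Multiset.card_add, Multiset.card_replicate, Multiset.card_zero] at this ⊢
      omega
    · simpa using congrArg Multiset.card h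

theorem replicate_sr_count (hn : 2 ≤ n) (a b : ℕ) :
    (Multiset.replicate a (sr 0) + Multiset.replicate b (sr 1) :
      Multiset (DihedralGroup n)).count (sr 0) = a ∧
    (Multiset.replicate a (sr 0) + Multiset.replicate b (sr 1) :
      Multiset (DihedralGroup n)).count (sr 1) = b := by
  have hne := sr_zero_ne_sr_one hn
  simp [Multiset.count_add, Multiset.count_replicate, hne, hne.symm]

theorem replicate_sr_supp {a b : ℕ} : ∀ x ∈ (Multiset.replicate a (sr 0) +
    Multiset.replicate b (sr 1) : Multiset (DihedralGroup n)), x = sr 0 ∨ x = sr 1 := fun _ hx =>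
  (Multiset.mem_add.1 hx).imp Multiset.eq_of_mem_replicate Multiset.eq_of_mem_replicate

theorem replicate_sr_mem_productOne :
    (Multiset.replicate n (sr 0) + Multiset.replicate n (sr 1)) ∈ productOne (DihedralGroup n) := by
  have key : ∀ k : ℕ, ∃ l : List (DihedralGroup n),
      (l : Multiset (DihedralGroup n)) = Multiset.replicate k (sr 0) + Multiset.replicate k (sr 1) ∧
      l.prod = r k := by
    intro k
    induction k with
    | zero => exact ⟨[], by simp, by simp⟩
    | succ k ih =>
      obtain ⟨l, hl, hp⟩ := ih
      refine ⟨sr 0 :: sr 1 :: l, ?_, ?_⟩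
      · rw [← Multiset.cons_coe, ← Multiset.cons_coe, hl, Multiset.replicate_succ,
          Multiset.replicate_succ, Multiset.cons_add, Multiset.add_cons]
      · rw [List.prod_cons, List.prod_cons, hp, sr_mul_r, sr_mul_sr]
        push_cast
        congr 1
        ring
  obtain ⟨l, hl, hp⟩ := key n
  exact ⟨l, hl, by rw [hp, ZMod.natCast_self, r_zero]⟩

/-- As n is odd, one of two factors has odd counts, and it already uses all n copies of both
reflections. -/
theorem isProductOneAtom_replicate_sr (hn : 2 ≤ n) (hodd : n % 2 = 1) :
    IsProductOneAtom
      (Multiset.replicate n (sr 0) + Multiset.replicate n (sr 1) : Multiset (DihedralGroup n)) := by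
  refine ⟨replicate_sr_mem_productOne, fun h => ?_, fun A hA B hB hAB => ?_⟩
  · have := congrArg Multiset.card h
    simp only [Multiset.card_add, Multiset.card_replicate, Multiset.card_zero] at this
    omega
  · have hsA : ∀ x ∈ A, x = sr 0 ∨ x = sr 1 := fun x hx =>
      replicate_sr_supp x (hAB ▸ Multiset.mem_add.2 (Or.inl hx))
    have hsB : ∀ x ∈ B, x = sr 0 ∨ x = sr 1 := fun x hx =>
      replicate_sr_supp x (hAB ▸ Multiset.mem_add.2 (Or.inr hx))
    have hcA := count_of_mem_productOne hn hA hsA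
    have hcB := count_of_mem_productOne hn hB hsB
    have h0 := congrArg (Multiset.count (sr 0)) hAB
    have h1 := congrArg (Multiset.count (sr 1)) hAB
    rw [(replicate_sr_count hn n n).1, Multiset.count_add] at h0
    rw [(replicate_sr_count hn n n).2, Multiset.count_add] at h1
    have heA := eq_replicate_add_replicate (sr_zero_ne_sr_one hn) hsA
    have heB := eq_replicate_add_replicate (sr_zero_ne_sr_one hn) hsB
    generalize A.count (sr 0) = a at *
    generalize A.count (sr 1) = a' at *
    generalize B.count (sr 0) = b at *
    generalize B.count (sr 1) = b' at *
    have : (a = 0 ∧ a' = 0) ∨ (b = 0 ∧ b' = 0) := by omega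
    rcases this with ⟨rfl, rfl⟩ | ⟨rfl, rfl⟩
    · exact Or.inl (by simpa using heA)
    · exact Or.inr (by simpa using heB)

/-- Atoms with even counts are pairs. As the total counts 2n are even, an atom with odd counts is
accompanied by another; each uses at least n copies of both reflections, so the two exhaust the
sequence. -/
theorem lengths_replicate_sr (hn : 2 ≤ n) (hodd : n % 2 = 1) :
    lengths (Multiset.replicate n (sr 0) + Multiset.replicate n (sr 1) +
      (Multiset.replicate n (sr 0) + Multiset.replicate n (sr 1)) : Multiset (DihedralGroup n)) =
      {2, 2 * n} := by
  have hU := isProductOneAtom_replicate_sr hn hodd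
  set U : Multiset (DihedralGroup n) := Multiset.replicate n (sr 0) + Multiset.replicate n (sr 1)
    with hUdef
  have hinv : U.map (·⁻¹) = U := by
    rw [hUdef, Multiset.map_add, Multiset.map_replicate, Multiset.map_replicate, inv_sr, inv_sr]
  have h1 : (1 : DihedralGroup n) ∉ U := fun h => by
    rcases replicate_sr_supp _ h with h | h
    all_goals
      rw [one_def] at h
      cases h
  have hcU : U.card = 2 * n := by
    rw [hUdef, Multiset.card_add, Multiset.card_replicate, Multiset.card_replicate, two_mul]
  refine Set.Subset.antisymm ?_ (by simpa only [hinv, hcU] using hU.subset_lengths h1)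
  rintro k ⟨s, hs, rfl, hsum⟩
  have hsupp : ∀ u ∈ s, ∀ x ∈ u, x = sr 0 ∨ x = sr 1 := by
    intro u hu x hx
    have : x ∈ s.sum := mem_multiset_sum_iff.2 ⟨u, hu, hx⟩
    rw [hsum, Multiset.mem_add, or_self] at this
    exact replicate_sr_supp x this
  have hcount : ∀ u ∈ s, _ := fun u hu => count_of_mem_productOne hn (hs u hu).1 (hsupp u hu)
  by_cases heven : ∀ u ∈ s, u.count (sr 0) % 2 = 0
  · right
    have hcard : ∀ u ∈ s, u.card = 2 := by
      intro u hu
      have h0 := heven u hu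
      have h1 := hcount u hu
      exact card_eq_two_of_count_even hn (hs u hu) (hsupp u hu) h0 (by omega)
    have := card_sum_eq_mul_card hcard
    rw [hsum, Multiset.card_add, hcU] at this
    change s.card = 2 * n
    omega
  · left
    push Not at heven
    obtain ⟨u, hu, hu2⟩ := heven
    have hcu := hcount u hu
    obtain ⟨t, rfl⟩ := Multiset.exists_cons_of_mem hu
    rw [Multiset.sum_cons] at hsum
    have e0 := congrArg (Multiset.count (sr 0)) hsum
    have e1 := congrArg (Multiset.count (sr 1)) hsum
    rw [Multiset.count_add, Multiset.count_add, hUdef, (replicate_sr_count hn n n).1] at e0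
    rw [Multiset.count_add, Multiset.count_add, hUdef, (replicate_sr_count hn n n).2] at e1
    have hodd' : ∃ v ∈ t, v.count (sr 0) % 2 ≠ 0 := by
      by_contra! hall
      have := count_sum_even hall
      omega
    obtain ⟨v, hv, hv2⟩ := hodd'
    have hcv := hcount v (Multiset.mem_cons_of_mem hv)
    obtain ⟨w, rfl⟩ := Multiset.exists_cons_of_mem hv
    rw [Multiset.sum_cons, Multiset.count_add] at e0 e1
    have huv : u.card + v.card = 2 * n + 2 * n := by
      have hcard : ∀ z : Multiset (DihedralGroup n), (∀ x ∈ z, x = sr 0 ∨ x = sr 1) →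
          z.card = z.count (sr 0) + z.count (sr 1) := fun z hz => by
        conv_lhs => rw [eq_replicate_add_replicate (sr_zero_ne_sr_one hn) hz]
        simp
      rw [hcard u (hsupp u hu), hcard v (hsupp v (Multiset.mem_cons_of_mem hv))]
      omega
    have hw : w = 0 := by
      by_contra hw0
      obtain ⟨z, hz⟩ := Multiset.exists_mem_of_ne_zero hw0
      have h2 := Multiset.card_le_card (Multiset.le_sum_of_mem hz)
      have h3 := Multiset.card_pos.2
        (hs z (Multiset.mem_cons_of_mem (Multiset.mem_cons_of_mem hz))).2.1
      have h4 := congrArg Multiset.card hsum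
      rw [Multiset.sum_cons, Multiset.card_add, Multiset.card_add, Multiset.card_add, hcU] at h4
      omega
    simp [hw]

theorem davenport_eq (hn : 3 ≤ n) (hodd : n % 2 = 1) : davenport (DihedralGroup n) = 2 * n := by
  have : NeZero n := ⟨by omega⟩
  apply le_antisymm
  · rw [← nat_card (n := n)]
    exact davenport_le_card
  · have := (isProductOneAtom_replicate_sr (n := n) (by omega) hodd).card_le
    rwa [Multiset.card_add, Multiset.card_replicate, Multiset.card_replicate, ← two_mul] at this

theorem two_davenport_mem_systemOfLengths (hn : 3 ≤ n) (hodd : n % 2 = 1) :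
    {2, davenport (DihedralGroup n)} ∈ systemOfLengths (DihedralGroup n) := by
  rw [davenport_eq hn hodd]
  have h := lengths_replicate_sr (n := n) (by omega) hodd
  exact mem_systemOfLengths_iff.2
    ⟨_, mem_productOne_of_mem_lengths (k := 2) (by rw [h]; simp), h⟩

/-! ### Dihedral groups: the atom made of a rotation and a reflection. -/

/-- The possible products of a list with terms `r 1` and `sr 0`. -/
theorem prod_list_r_sr (l : List (DihedralGroup n)) (hl : ∀ x ∈ l, x = r 1 ∨ x = sr 0) :
    ∃ t : ℤ, (t - l.count (r 1)) % 2 = 0 ∧ t ≤ l.count (r 1) ∧ -t ≤ l.count (r 1) ∧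
      ((l.count (sr 0) % 2 = 0 ∧ l.prod = r t) ∨ (l.count (sr 0) % 2 = 1 ∧ l.prod = sr t)) := by
  have hne : (r 1 : DihedralGroup n) ≠ sr 0 := by simp
  induction l with
  | nil => exact ⟨0, by simp⟩
  | cons x l ih =>
    obtain ⟨t, h1, h2, h3, h4⟩ := ih fun y hy => hl y (List.mem_cons_of_mem x hy)
    rcases hl x List.mem_cons_self with rfl | rfl
    · simp only [List.count_cons_self, List.count_cons_of_ne hne, List.prod_cons]
      rcases h4 with ⟨h5, h6⟩ | ⟨h5, h6⟩
      · refine ⟨t + 1, by omega, by omega, by omega, Or.inl ⟨h5, ?_⟩⟩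
        rw [h6, r_mul_r]
        push_cast
        rw [add_comm]
      · refine ⟨t - 1, by omega, by omega, by omega, Or.inr ⟨h5, ?_⟩⟩
        rw [h6, r_mul_sr]
        push_cast
        rfl
    · simp only [List.count_cons_self, List.count_cons_of_ne hne.symm, List.prod_cons]
      rcases h4 with ⟨h5, h6⟩ | ⟨h5, h6⟩
      · exact ⟨t, h1, h2, h3, Or.inr ⟨by omega, by rw [h6, sr_mul_r, zero_add]⟩⟩
      · exact ⟨t, h1, h2, h3, Or.inl ⟨by omega, by rw [h6, sr_mul_sr, sub_zero]⟩⟩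

theorem count_of_mem_productOne_r_sr {T : Multiset (DihedralGroup n)}
    (hT : T ∈ productOne (DihedralGroup n)) (hsupp : ∀ x ∈ T, x = r 1 ∨ x = sr 0) :
    T.count (sr 0) % 2 = 0 ∧ (T.count (r 1) % 2 = 1 → n ≤ T.count (r 1)) := by
  obtain ⟨l, rfl, hl⟩ := hT
  simp only [Multiset.coe_count]
  obtain ⟨t, h1, h2, h3, ⟨h5, h6⟩ | ⟨h5, h6⟩⟩ :=
    prod_list_r_sr l fun x hx => hsupp x (Multiset.mem_coe.2 hx)
  · refine ⟨h5, fun h => ?_⟩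
    rw [hl] at h6
    have := le_abs_of_dvd_of_odd (dvd_of_r_eq_one h6.symm) (by omega)
    omega
  · rw [hl, one_def] at h6
    cases h6

/-- The ordering used is the square of a reflection. By parity one of two factors has no `sr 0`, so
it consists of 0 or n copies of `r 1`. In the latter case the other factor has n - 2 copies, an odd
number below n, which is impossible. -/
theorem isProductOneAtom_replicate_r_sr (hn : 3 ≤ n) (hodd : n % 2 = 1) :
    IsProductOneAtom (Multiset.replicate (2 * n - 2) (r 1) + Multiset.replicate 2 (sr 0) :
      Multiset (DihedralGroup n)) := by
  have hne : (r 1 : DihedralGroup n) ≠ sr 0 := by simp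
  refine ⟨?_, fun h => ?_, fun A hA B hB hAB => ?_⟩
  · refine ⟨(List.replicate (n - 1) (r 1) ++ [sr 0]) ++ (List.replicate (n - 1) (r 1) ++ [sr 0]),
      ?_, ?_⟩
    · rw [show 2 * n - 2 = (n - 1) + (n - 1) by omega, Multiset.replicate_add]
      simp only [← Multiset.coe_add, Multiset.coe_replicate, Multiset.coe_singleton]
      rw [show (2 : ℕ) = 1 + 1 from rfl, Multiset.replicate_add, Multiset.replicate_one]
      abel
    · simp only [List.prod_append, List.prod_replicate, List.prod_singleton, r_one_pow, r_mul_sr,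
        sr_mul_self]
  · have := congrArg Multiset.card h
    simp at this
  · have hs : ∀ x ∈ A + B, x = r 1 ∨ x = sr 0 := fun x hx => by
      rw [hAB] at hx
      exact (Multiset.mem_add.1 hx).imp Multiset.eq_of_mem_replicate Multiset.eq_of_mem_replicate
    have hsA : ∀ x ∈ A, x = r 1 ∨ x = sr 0 := fun x hx => hs x (Multiset.mem_add.2 (Or.inl hx))
    have hsB : ∀ x ∈ B, x = r 1 ∨ x = sr 0 := fun x hx => hs x (Multiset.mem_add.2 (Or.inr hx))
    have key : ∀ {A B : Multiset (DihedralGroup n)}, A ∈ productOne (DihedralGroup n) →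
        B ∈ productOne (DihedralGroup n) → (∀ x ∈ A, x = r 1 ∨ x = sr 0) →
        (∀ x ∈ B, x = r 1 ∨ x = sr 0) →
        A.count (r 1) + B.count (r 1) = 2 * n - 2 → A.count (sr 0) = 0 → A = 0 := by
      intro A B hA hB hsA hsB hc h0
      have heA := eq_replicate_add_replicate hne hsA
      rw [h0, Multiset.replicate_zero, add_zero] at heA
      have hcB := count_of_mem_productOne_r_sr hB hsB
      have hdvd : n ∣ A.count (r 1) := by
        obtain ⟨l, rfl, hl⟩ := hA
        rw [← Multiset.coe_replicate, Multiset.coe_eq_coe] at heA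
        rw [List.perm_replicate.1 heA, List.prod_replicate] at hl
        have := orderOf_dvd_of_pow_eq_one hl
        rwa [orderOf_r_one] at this
      obtain ⟨c, hc'⟩ := hdvd
      have hc2 : c < 2 := by
        by_contra! h
        have := Nat.mul_le_mul_left n h
        omega
      interval_cases c
      · rw [heA, hc']
        simp
      · have := hcB.2 (by omega)
        omega
    have e0 := congrArg (Multiset.count (r 1)) hAB
    have e1 := congrArg (Multiset.count (sr 0)) hAB
    have h0 : (Multiset.replicate (2 * n - 2) (r 1) + Multiset.replicate 2 (sr 0) :
        Multiset (DihedralGroup n)).count (r 1) = 2 * n - 2 := by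
      rw [Multiset.count_add, Multiset.count_replicate_self, Multiset.count_replicate,
        if_neg hne.symm, add_zero]
    have h1 : (Multiset.replicate (2 * n - 2) (r 1) + Multiset.replicate 2 (sr 0) :
        Multiset (DihedralGroup n)).count (sr 0) = 2 := by
      rw [Multiset.count_add, Multiset.count_replicate_self, Multiset.count_replicate,
        if_neg hne, zero_add]
    rw [h0, Multiset.count_add] at e0
    rw [h1, Multiset.count_add] at e1
    have hcA := count_of_mem_productOne_r_sr hA hsA
    have hcB := count_of_mem_productOne_r_sr hB hsB
    have : A.count (sr 0) = 0 ∨ B.count (sr 0) = 0 := by omega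
    rcases this with h | h
    · exact Or.inl (key hA hB hsA hsB e0 h)
    · exact Or.inr (key hB hA hsB hsA (by omega) h)

theorem exists_ssuperset_mem_systemOfLengths (hn : 3 ≤ n) (hodd : n % 2 = 1) :
    ∃ L ∈ systemOfLengths (DihedralGroup n), {2, davenport (DihedralGroup n)} ⊂ L := by
  have : NeZero n := ⟨by omega⟩
  have hone : ∀ m : ℕ, (1 : DihedralGroup n) ∉
      Multiset.replicate m (r 1) + Multiset.replicate 2 (sr 0) := fun m h => by
    have : Fact (1 < n) := ⟨by omega⟩
    rw [Multiset.mem_add] at h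
    rcases h with h | h
    · have h1 := Multiset.eq_of_mem_replicate h
      rw [one_def, r.injEq] at h1
      exact zero_ne_one h1
    · have h1 := Multiset.eq_of_mem_replicate h
      rw [one_def] at h1
      cases h1
  have hsub := (isProductOneAtom_replicate_r_sr hn hodd).subset_lengths (hone _)
  rw [Multiset.card_add, Multiset.card_replicate, Multiset.card_replicate,
    show 2 * n - 2 + 2 = 2 * n by omega, ← davenport_eq hn hodd] at hsub
  refine ⟨_, mem_systemOfLengths_iff.2
    ⟨_, mem_productOne_of_mem_lengths (k := 2) (hsub (by simp)), rfl⟩, hsub, fun h => ?_⟩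
  -- Split off n copies of `r 1` and n copies of its inverse as two atoms and pair the remaining n
  -- terms with their inverses. The length n + 2 lies strictly between 2 and 2n.
  have hr := isProductOneAtom_replicate_orderOf (r 1 : DihedralGroup n)
  rw [orderOf_r_one] at hr
  have hm := add_mem_lengths
    (add_mem_lengths hr.one_mem_lengths hr.map_inv.one_mem_lengths)
    (card_mem_lengths_add_map_inv (hone (n - 2)))
  have hm' := h (show 1 + 1 + (Multiset.replicate (n - 2) (r 1) + Multiset.replicate 2 (sr 0) :
    Multiset (DihedralGroup n)).card ∈ lengths _ by
      convert hm using 2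
      rw [davenport_eq hn hodd, show 2 * n - 2 = n + (n - 2) by omega]
      simp only [Multiset.replicate_add, Multiset.map_add]
      abel)
  rw [davenport_eq hn hodd, Multiset.card_add, Multiset.card_replicate,
    Multiset.card_replicate] at hm'
  simp only [Set.mem_insert_iff, Set.mem_singleton_iff] at hm'
  omega

end DihedralGroup

/-! ### The main theorem. -/

theorem theorem4p4 {G Gs : Type*} [Group G] [Finite G] [Group Gs] [Finite Gs]
    (n : ℕ) (hn : 3 ≤ n) (hodd : Odd n) :
    (3 ≤ Nat.card G → Odd (Nat.card G) →
      ({2, davenport G} ∈ systemOfLengths G ↔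
        Nonempty (G ≃* Multiplicative (ZMod (davenport G))))) ∧
    (3 ≤ Nat.card G → Odd (Nat.card G) → IsCyclic Gs →
      systemOfLengths Gs = systemOfLengths G → Nonempty (Gs ≃* G)) ∧
    ({2, davenport (DihedralGroup n)} ∈ systemOfLengths (DihedralGroup n) ∧
      ∃ L ∈ systemOfLengths (DihedralGroup n), {2, davenport (DihedralGroup n)} ⊂ L) ∧
    ((∀ x y : Gs, x * y = y * x) →
      systemOfLengths Gs ≠ systemOfLengths (DihedralGroup n)) := by
  have : NeZero n := ⟨by omega⟩
  have hn2 := Nat.odd_iff.1 hodd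
  have hmem := DihedralGroup.two_davenport_mem_systemOfLengths hn hn2
  have hsup := DihedralGroup.exists_ssuperset_mem_systemOfLengths hn hn2
  refine ⟨two_davenport_mem_iff, nonempty_mulEquiv_of_systemOfLengths_eq, ⟨hmem, hsup⟩, ?_⟩
  intro hcomm h
  have hD := DihedralGroup.davenport_eq hn hn2
  -- Equal systems carry both {2, D} and a proper superset of it over to the abelian group, against
  -- maximality.
  rw [davenport_eq_of_systemOfLengths_eq h.symm (by omega), ← h] at hmem hsup
  have hDs := davenport_eq_of_systemOfLengths_eq h.symm (by omega)
  obtain ⟨L, hL, hsub⟩ := hsup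
  let _ : CommGroup Gs := { ‹Group Gs› with mul_comm := hcomm }
  exact hsub.ne (eq_of_subset_of_mem_systemOfLengths (by omega) hmem hL hsub.subset).symm
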